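/- Write $\partial=\frac{d}{dz}$, $\vartheta=z\partial$. Let $L=\sum_{i=0}^{d}a_i\partial^i\in\mathbb{Q}(z)[\partial]$ have degree (order) $d\ge 1$, $a_d\neq 0$; operators that differ by left multiplication by a nonzero rational function are identified (so one may take $L\in\mathbb{Q}[z,\vartheta]$, or $L$ monic). A series $\sum_m A_mz^m\in\mathbb{Q}[[z]]$ is called N-integral if there is an integer $N\geq 1$ with $N^mA_m\in\mathbb{Z}$ for all $m\ge 0$. A flag of $L$ at $z=0$ is a tuple of solutions $y_k=\sum_{j=0}^{k}\frac{1}{j!}\ln(z)^jf_{k-j}$, $0\le k\le d-1$, of $L$ with $f_i\in\mathbb{Q}[[z]]$ and $f_0\in z^r(1+z\mathbb{Q}[[z]])$ for some integer $r\ge 0$. Put $\mathcal{N}_0=1$ and $\mathcal{N}_{k+1}=\vartheta\,\frac{1}{\mathcal{N}_k(y_k)}\,\mathcal{N}_k$. The structure series of $L$ are $\alpha_k=\mathcal{N}_k(y_k)^{-1}$, $1\le k\le d-1$, and, if $d\geq 2$, the special coordinate is the series $q\in z+z^2\mathbb{Q}[[z]]$ with $\vartheta q=\alpha_1^{-1}q$,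 i.e. $q=\exp(y_1/y_0)$ up to a constant factor. The operator $L$ is of CY-type if it is irreducible in $\mathbb{Q}(z)[\partial]$ and (P) there is $0\ne\alpha\in\mathbb{Q}(z)$ with $L\alpha=\alpha L^{\vee}$, where $L^\vee=\sum_{i=0}^{d}(-1)^{d+i}\partial^ia_i$; (M) $z=0$ is a regular singular (or regular) point of $L$ and all exponents of $L$ at $z=0$ are integers and equal, i.e. the indicial polynomial at $z=0$ is $(T-r)^{d}$ for some $r\in\mathbb{Z}$; (N) $L$ has a nonzero N-integral solution in $\mathbb{Q}[[z]]$; (Q) if $d\ge2$, the special coordinate of $L$ at $z=0$ is N-integral; (S) all structure series $\alpha_1,\dots,\alpha_{d-1}$ of $L$ at $z=0$ are N-integral power series. For a nonzero algebraic function $g\in\mathbb{Q}(z)^{alg}$, let $L\otimes g=g\circ L\circ g^{-1}$, the operator whose solutions are the products $gy$ with $L(y)=0$. For an operator $P$ of positive degree with differential module $M_P=\mathbb{Q}(z)[\partial]/\mathbb{Q}(z)[\partial]P$ and $e\in M_P$ the class of $1$, let $\mathrm{Sym}^2(P)$ be the operator of least degree that annihilates $e\cdot e\in \mathrm{Sym}^2(M_P)$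 (unique up to left multiplication by a nonzero rational function). Corollary (Fano: degree three). For every CY-type operator $L$ of degree three there are a nonzero algebraic function $g\in\mathbb{Q}(z)^{alg}$ and a CY-type operator $P$ of degree two such that $L\otimes g=\mathrm{Sym}^2(P)$ (up to left multiplication by a nonzero rational function). -/

import Mathlib

open Polynomial

noncomputable section

namespace CYOp

/-! ## Derivations on `ℚ(z)` and on its algebraic closure -/

/-- Extension of a derivation `D` of `A` along a formally étale map `A → B`
(for instance a localization, or an algebraic extension of fields of characteristic zero). -/
def extendDer {A B : Type} [CommRing A] [CommRing B] [Algebra ℚ A] [Algebra ℚ B] [Algebra A B]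
    [IsScalarTower ℚ A B] [Algebra.FormallyEtale A B] (D : Derivation ℚ A A) :
    Derivation ℚ B B :=
  ((LinearMap.liftBaseChange B ((Algebra.linearMap A B).comp D.liftKaehlerDifferential)).comp
    (KaehlerDifferential.tensorKaehlerEquivOfFormallyEtale ℚ A B).symm.toLinearMap).compDer
    (KaehlerDifferential.D ℚ B)

theorem extendDer_algebraMap {A B : Type} [CommRing A] [CommRing B] [Algebra ℚ A] [Algebra ℚ B]
    [Algebra A B] [IsScalarTower ℚ A B] [Algebra.FormallyEtale A B] (D : Derivation ℚ A A)
    (a : A) : (extendDer D : Derivation ℚ B B) (algebraMap A B a) = algebraMap A B (D a) := by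
  simp [extendDer, KaehlerDifferential.tensorKaehlerEquivOfFormallyEtale_symm_D_algebraMap]

/-- The field `ℚ(z)` of rational functions. -/
abbrev Qz : Type := RatFunc ℚ

/-- The field `ℚ(z)^alg` of algebraic functions. -/
abbrev Qalg : Type := AlgebraicClosure Qz

instance formallyEtale_Qz : Algebra.FormallyEtale ℚ[X] Qz :=
  Algebra.FormallyEtale.of_isLocalization (nonZeroDivisors ℚ[X])

instance formallyEtale_Qalg : Algebra.FormallyEtale Qz Qalg :=
  Algebra.FormallyEtale.of_isSeparable Qz Qalg

/-- `d/dz` on `ℚ(z)`: the derivation extending the derivative of polynomials. -/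
def dz : Derivation ℚ Qz Qz := extendDer Polynomial.derivative'

/-- `d/dz` on `ℚ(z)^alg`: the derivation extending `d/dz` on `ℚ(z)`. -/
def dalg : Derivation ℚ Qalg Qalg := extendDer dz

theorem dz_algebraMap (p : ℚ[X]) :
    dz (algebraMap ℚ[X] Qz p) = algebraMap ℚ[X] Qz (derivative p) :=
  extendDer_algebraMap _ p

theorem dalg_algebraMap (a : Qz) : dalg (algebraMap Qz Qalg a) = algebraMap Qz Qalg (dz a) :=
  extendDer_algebraMap _ a

/-! ## Differential operators

A differential operator `∑ aᵢ ∂ⁱ` with coefficients in a field `K` is given by the polynomial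
`∑ aᵢ Xⁱ` of its coefficients; its degree (order) is `natDegree`. The multiplication of `K[X]` is
not the one of operators; the composition of operators is `opComp`. -/

/-- The action of `L = ∑ aᵢ ∂ⁱ` on a `K`-module `M` on which `∂` acts by `T`. -/
def act {K M : Type} [Field K] [AddCommGroup M] [Module K M] (T : M → M) (L : K[X]) (m : M) : M :=
  L.sum fun i a => a • T^[i] m

/-- Apply `D` to all coefficients of a polynomial. -/
def mapCoeffs {A : Type} [CommRing A] (D : A → A) (p : A[X]) : A[X] :=
  p.sum fun i a => monomial i (D a)

/-- The operator `∂ ∘ L`, by the rule `∂ ∘ a = a ∘ ∂ + a'`. -/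
def dComp {K : Type} [Field K] (D : K → K) (L : K[X]) : K[X] := X * L + mapCoeffs D L

/-- The composition `A ∘ B` of differential operators. -/
def opComp {K : Type} [Field K] (D : K → K) (A B : K[X]) : K[X] := act (dComp D) A B

/-- Irreducibility of an operator over `ℚ(z)`. -/
def IsIrreducible (L : Qz[X]) : Prop :=
  0 < L.natDegree ∧ ∀ A B : Qz[X], L = opComp dz A B → A.natDegree = 0 ∨ B.natDegree = 0

/-- The dual `L^∨ = ∑ (-1)^(d+i) ∂ⁱ ∘ aᵢ` of `L = ∑ aᵢ ∂ⁱ` of degree `d`. -/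
def dual (L : Qz[X]) : Qz[X] :=
  ∑ i ∈ Finset.range (L.natDegree + 1),
    (-1) ^ (L.natDegree + i) * (dComp dz)^[i] (C (L.coeff i))

/-- For algebraic `g ≠ 0`, the operator `L ⊗ g = g ∘ L ∘ g⁻¹`, whose solutions are the products
`g y` with `L y = 0`. -/
def tensorFun (L : Qalg[X]) (g : Qalg) : Qalg[X] := opComp dalg (C g) (opComp dalg L (C g⁻¹))

/-! ## Symmetric powers

For `P` of degree `n`, the symmetric algebra of the differential module
`M_P = ℚ(z)[∂] / ℚ(z)[∂] P` is the polynomial ring in `xᵢ = ∂ⁱ e`, `0 ≤ i < n`, where `e` is the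
class of `1`. -/

/-- The class of `∂ⁱ⁺¹` in `M_P`, expressed through the basis `x₀, …, x_{n-1}`. -/
def nextVar (P : Qz[X]) (i : Fin P.natDegree) : MvPolynomial (Fin P.natDegree) Qz :=
  if h : (i : ℕ) + 1 < P.natDegree then MvPolynomial.X ⟨i + 1, h⟩
  else - ∑ j : Fin P.natDegree, MvPolynomial.C (P.coeff j / P.leadingCoeff) * MvPolynomial.X j

/-- The action of `∂` on the symmetric algebra of `M_P`: the derivation that extends `d/dz` on
`ℚ(z)` and the action of `∂` on `M_P`. -/
def symD (P : Qz[X]) (p : MvPolynomial (Fin P.natDegree) Qz) :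
    MvPolynomial (Fin P.natDegree) Qz :=
  (∑ s ∈ p.support, MvPolynomial.monomial s (dz (p.coeff s))) +
    ∑ i, MvPolynomial.pderiv i p * nextVar P i

/-- `Q` is, up to left multiplication by a nonzero rational function, the `k`-th symmetric power of
`P`: the operator of least degree that annihilates `e ⋯ e` (`k` factors) in `Sym^k M_P`. -/
def IsSymPower (k : ℕ) (P Q : Qz[X]) : Prop :=
  Q ≠ 0 ∧ ∃ h : 0 < P.natDegree,
    act (symD P) Q (MvPolynomial.X ⟨0, h⟩ ^ k) = 0 ∧
    ∀ R : Qz[X], R ≠ 0 → act (symD P) R (MvPolynomial.X ⟨0, h⟩ ^ k) = 0 →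
      Q.natDegree ≤ R.natDegree

/-! ## Local solutions at `z = 0` -/

/-- `ℚ((z))` as an algebra over `ℚ(z)`, by Laurent expansion at `z = 0`. -/
instance laurentExpansion : Algebra Qz (LaurentSeries ℚ) := RatFunc.liftAlgebra ℚ _

instance laurentExpansion_isScalarTower : IsScalarTower ℚ[X] Qz (LaurentSeries ℚ) :=
  RatFunc.isScalarTower_liftAlgebra ℚ _

/-- The Laurent expansion at `z = 0` of `z^(d-i) aᵢ / a_d`, for `L = ∑ aᵢ ∂ⁱ` of degree `d`. -/
def normCoeff (L : Qz[X]) (i : ℕ) : LaurentSeries ℚ :=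
  algebraMap Qz (LaurentSeries ℚ)
    (RatFunc.X ^ (L.natDegree - i) * L.coeff i / L.leadingCoeff)

/-- `z = 0` is a regular (possibly singular) point: all `z^(d-i) aᵢ / a_d` are holomorphic
there. -/
def IsRegularAtZero (L : Qz[X]) : Prop :=
  ∀ i ≤ L.natDegree, ∀ m : ℤ, m < 0 → (normCoeff L i).coeff m = 0

/-- The indicial polynomial at `z = 0`. Its roots are the exponents at `z = 0`. -/
def indicial (L : Qz[X]) : ℚ[X] :=
  ∑ i ∈ Finset.range (L.natDegree + 1), C ((normCoeff L i).coeff 0) * descPochhammer ℚ i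

/-- `∑ A_m z^m` is N-integral if `N^m A_m ∈ ℤ` for all `m`, for some positive integer `N`. -/
def NIntegral (y : PowerSeries ℚ) : Prop :=
  ∃ N : ℕ, 0 < N ∧ ∀ m : ℕ, ∃ a : ℤ, (N : ℚ) ^ m * PowerSeries.coeff m y = a

/-- Polynomials in `ℓ = ln z` with coefficients in `ℚ((z))`. -/
abbrev LogSeries : Type := (LaurentSeries ℚ)[X]

/-- `d/dz` on `ℚ((z))[ln z]`, with `d(ln z)/dz = 1/z`. -/
def dlog (p : LogSeries) : LogSeries :=
  mapCoeffs (LaurentSeries.derivative ℚ) p + C (HahnSeries.single (-1) 1) * derivative p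

/-- The Euler operator `ϑ = z d/dz` on `ℚ((z))[ln z]`. -/
def theta (p : LogSeries) : LogSeries := C (HahnSeries.single 1 1) * dlog p

/-- `y_k = ∑_{j ≤ k} (1/j!) (ln z)^j f_{k-j}`. -/
def flagFun (f : ℕ → PowerSeries ℚ) (k : ℕ) : LogSeries :=
  ∑ j ∈ Finset.range (k + 1),
    C (((j.factorial : ℚ)⁻¹ • f (k - j) : PowerSeries ℚ) : LaurentSeries ℚ) * X ^ j

/-- `f₀, …, f_{d-1}` define a flag `y₀, …, y_{d-1}` of solutions of `L` at `z = 0`. -/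
def IsFlag (L : Qz[X]) (f : ℕ → PowerSeries ℚ) : Prop :=
  (∃ (r : ℕ) (u : PowerSeries ℚ), PowerSeries.constantCoeff u = 1 ∧
    f 0 = PowerSeries.X ^ r * u) ∧
  ∀ k < L.natDegree, act dlog L (flagFun f k) = 0

/-- `normalSeq f k j = 𝒩_k(y_j)`, where `𝒩₀ = 1` and `𝒩_{k+1} = ϑ ∘ (1 / 𝒩_k(y_k)) ∘ 𝒩_k`.
For a flag, `𝒩_k(y_k)` does not involve `ln z` and is invertible in `ℚ((z))`. -/
def normalSeq (f : ℕ → PowerSeries ℚ) : ℕ → ℕ → LogSeries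
  | 0, j => flagFun f j
  | k + 1, j => theta (C ((normalSeq f k k).coeff 0)⁻¹ * normalSeq f k j)

/-- The structure series `α_k = 𝒩_k(y_k)⁻¹`. -/
def structureSeries (f : ℕ → PowerSeries ℚ) (k : ℕ) : LaurentSeries ℚ :=
  ((normalSeq f k k).coeff 0)⁻¹

/-- `q` is the special coordinate `exp (y₁ / y₀) ∈ z ℚ⟦z⟧ˣ`: the solution of `ϑ q = α₁⁻¹ q` with
`q(0) = 0` and `q'(0) = 1`. -/
def IsSpecialCoordinate (f : ℕ → PowerSeries ℚ) (q : PowerSeries ℚ) : Prop :=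
  PowerSeries.coeff 0 q = 0 ∧ PowerSeries.coeff 1 q = 1 ∧
  ((PowerSeries.X * PowerSeries.derivative ℚ q : PowerSeries ℚ) : LaurentSeries ℚ) =
    (structureSeries f 1)⁻¹ * (q : LaurentSeries ℚ)

/-- Differential operators of CY-type. -/
structure IsCYType (L : Qz[X]) : Prop where
  irreducible : IsIrreducible L
  /-- (P): self-duality. -/
  selfDual : ∃ α : Qz, α ≠ 0 ∧ opComp dz L (C α) = opComp dz (C α) (dual L)
  /-- (M): all exponents at `z = 0` are integers and equal. -/
  mum : IsRegularAtZero L ∧ ∃ r : ℤ, indicial L = (X - C (r : ℚ)) ^ L.natDegree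
  /-- (N): there is a (nonzero) N-integral solution at `z = 0`. -/
  nIntegralSolution : ∃ y : PowerSeries ℚ, y ≠ 0 ∧ NIntegral y ∧
    act (LaurentSeries.derivative ℚ) L (y : LaurentSeries ℚ) = 0
  /-- (Q): the special coordinate (defined for degree at least two) is N-integral. -/
  specialCoordinate : 2 ≤ L.natDegree →
    ∃ f q, IsFlag L f ∧ IsSpecialCoordinate f q ∧ NIntegral q
  /-- (S): the structure series `α₁, …, α_{d-1}` are N-integral. -/
  nIntegralStructure : ∃ f, IsFlag L f ∧ ∀ k, 1 ≤ k → k < L.natDegree →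
    ∃ s : PowerSeries ℚ, NIntegral s ∧ (s : LaurentSeries ℚ) = structureSeries f k

end CYOp

end

/-!
Up to its leading coefficient, write `L = ∂³ + 3s ∂² + t ∂ + a₀`. Self-duality `L α = α L^∨` says
two things: `a₀` is a differential polynomial in `s` and `t`, and `β' = -2 s β` has a nonzero
rational solution `β` (`exists_eq_selfDualCubic`). The first condition is exactly the one under
which the twist of `L` that makes it `∂³ + p ∂ + q` is the symmetric square of `∂² + p / 4`, and the
second one makes the twisting function algebraic. At a point with the single exponent `r`,
the exponents of `∂² + p / 4` are both `1 / 2`; the further twist by `z^(-1/2)` gives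
`P = ∂² + z⁻¹ ∂ + d` with exponents `0, 0`. Thus `L ⊗ g = Sym² P` (up to the leading coefficient) for
`g = (β z²)^(-1/2)`, where `g' = (s - z⁻¹) g` (`exists_twist`, `tensorFun_selfDualCubic`,
`isSymPower_two_symSquare`).

It remains to see that `P` is of CY-type (`isCYType_monicQuadratic`).

* Irreducibility: a right factor `∂ - ρ` of `P` gives the right factor `∂ - (2ρ - g' / g)` of `L`,
  which has rational coefficients (`selfDualCubic_eq_opComp`).
* Self-duality holds because `z⁻¹` is the logarithmic derivative of `z`.
* N-integrality: let `y = z^r u` solve `L`, and write `β = b z^(2r-2) U`, where `u` and `U` have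
  constant term one. Then `w² = (u² / U)^(1/2)` is a constant multiple of `g y`, and the cubic
  equation for `g y` says that `z² w³ P(w)` is constant. This constant is zero since `z² P(w)` is a
  power series without constant term, so `P(w) = 0` (`exists_sqrt_solution`). The series `U` comes
  from a rational function, and N-integral series with constant term one are closed under
  products, inverses and square roots (`NIntegral.mul`, `NIntegral.of_mul_eq_one`,
  `NIntegral.of_sq`).
* Flags: if `y` and `y τ` solve `L`, with `τ = ln z + h`, then `κ = z w² τ'` satisfies
  `(z w² κ')' = 0`. As derivatives of Laurent series have no residue, first `κ' = 0` and then `κ = 1`.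
  This says that `w τ` solves `P` and that `h` is a power series (`exists_flag_monicQuadratic`). The
  special coordinate and the first structure series are determined by `τ`, so those of `P` are
  those of `L`.
-/

noncomputable section

namespace CYOp

/-! ### Operators of low order -/

section Operators

variable {K M : Type} [Field K] [AddCommGroup M] [Module K M]

theorem act_eq_sum_range (T : M → M) (L : K[X]) (m : M) {n : ℕ} (h : L.natDegree < n) :
    act T L m = ∑ i ∈ Finset.range n, L.coeff i • T^[i] m :=
  Polynomial.sum_over_range' L (by simp) n h

theorem act_of_natDegree_le_one (T : M → M) (L : K[X]) (m : M) (h : L.natDegree ≤ 1) :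
    act T L m = L.coeff 0 • m + L.coeff 1 • T m := by
  simp [act_eq_sum_range T L m (Nat.lt_succ_of_le h), Finset.sum_range_succ]

theorem act_of_natDegree_le_two (T : M → M) (L : K[X]) (m : M) (h : L.natDegree ≤ 2) :
    act T L m = L.coeff 0 • m + L.coeff 1 • T m + L.coeff 2 • T (T m) := by
  simp [act_eq_sum_range T L m (Nat.lt_succ_of_le h), Finset.sum_range_succ]

theorem act_of_natDegree_le_three (T : M → M) (L : K[X]) (m : M) (h : L.natDegree ≤ 3) :
    act T L m =
      L.coeff 0 • m + L.coeff 1 • T m + L.coeff 2 • T (T m) + L.coeff 3 • T (T (T m)) := by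
  simp [act_eq_sum_range T L m (Nat.lt_succ_of_le h), Finset.sum_range_succ]

theorem act_C (T : M → M) (a : K) (m : M) : act T (C a) m = a • m := by
  simp [act]

theorem coeff_mapCoeffs {A : Type} [CommRing A] (D : A → A) (hD : D 0 = 0) (p : A[X]) (n : ℕ) :
    (mapCoeffs D p).coeff n = D (p.coeff n) := by
  simp only [mapCoeffs, Polynomial.sum, finsetSum_coeff, coeff_monomial]
  simp only [Finset.sum_ite_eq', mem_support_iff]
  split_ifs with h
  · rfl
  · rw [notMem_support_iff.mp h, hD]

end Operators

section OperatorComposition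

variable {K : Type} [Field K] [Algebra ℚ K] (D : Derivation ℚ K K)

theorem coeff_dComp_zero (p : K[X]) : (dComp D p).coeff 0 = D (p.coeff 0) := by
  simp [dComp, coeff_mapCoeffs D (map_zero D)]

theorem coeff_dComp_succ (p : K[X]) (n : ℕ) :
    (dComp D p).coeff (n + 1) = p.coeff n + D (p.coeff (n + 1)) := by
  simp [dComp, coeff_mapCoeffs D (map_zero D)]

theorem dComp_C (a : K) : dComp D (C a) = C a * X + C (D a) := by
  ext (_ | _ | n) <;>
  simp [coeff_dComp_zero, coeff_dComp_succ, coeff_C, coeff_X]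

theorem dComp_linear (a b : K) :
    dComp D (C a * X + C b) = C a * X ^ 2 + C (D a + b) * X + C (D b) := by
  ext (_ | _ | _ | n) <;>
  simp [-map_add, coeff_dComp_zero, coeff_dComp_succ, coeff_C, coeff_X, coeff_X_pow, add_comm b]

theorem dComp_quadratic (a b c : K) :
    dComp D (C a * X ^ 2 + C b * X + C c) =
      C a * X ^ 3 + C (D a + b) * X ^ 2 + C (D b + c) * X + C (D c) := by
  ext (_ | _ | _ | _ | n) <;>
  simp [-map_add, coeff_dComp_zero, coeff_dComp_succ, coeff_C, coeff_X, coeff_X_pow, add_comm b,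
    add_comm c]

theorem coeff_dComp_iterate_add (B : K[X]) (i : ℕ) :
    ((dComp D)^[i] B).natDegree ≤ B.natDegree + i ∧
      ((dComp D)^[i] B).coeff (B.natDegree + i) = B.leadingCoeff := by
  induction i with
  | zero => simp
  | succ i ih =>
    rw [Function.iterate_succ_apply']
    constructor
    · rw [natDegree_le_iff_coeff_eq_zero]
      rintro (_ | n) hn
      · omega
      · rw [coeff_dComp_succ, coeff_eq_zero_of_natDegree_lt (by omega),
          coeff_eq_zero_of_natDegree_lt (by omega), map_zero, add_zero]
    · rw [← add_assoc, coeff_dComp_succ, ih.2,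
        coeff_eq_zero_of_natDegree_lt (n := B.natDegree + i + 1) (by omega), map_zero, add_zero]

theorem natDegree_opComp {A B : K[X]} (hA : A ≠ 0) (hB : B ≠ 0) :
    (opComp D A B).natDegree = A.natDegree + B.natDegree := by
  rw [opComp, act_eq_sum_range _ _ _ (Nat.lt_succ_self A.natDegree)]
  apply natDegree_eq_of_le_of_coeff_ne_zero
  · refine natDegree_sum_le_of_forall_le _ _ fun i hi => ?_
    refine (natDegree_smul_le _ _).trans ((coeff_dComp_iterate_add D B i).1.trans ?_)
    rw [Finset.mem_range] at hi
    omega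
  · rw [finsetSum_coeff, Finset.sum_range_succ, Finset.sum_eq_zero, zero_add, coeff_smul,
      add_comm, (coeff_dComp_iterate_add D B _).2]
    · exact mul_ne_zero (leadingCoeff_ne_zero.mpr hA) (leadingCoeff_ne_zero.mpr hB)
    · intro i hi
      rw [Finset.mem_range] at hi
      rw [coeff_smul, coeff_eq_zero_of_natDegree_lt (p := (dComp D)^[i] B), smul_zero]
      have := (coeff_dComp_iterate_add D B i).1
      omega

theorem opComp_C_left (a : K) (B : K[X]) : opComp D (C a) B = C a * B := by
  rw [opComp, act_C, smul_eq_C_mul]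

theorem opComp_C_right_of_natDegree_le_three (L : K[X]) (h : L.natDegree ≤ 3) (b : K) :
    opComp D L (C b) =
      C (L.coeff 3 * b) * X ^ 3 + C (L.coeff 2 * b + 3 * L.coeff 3 * D b) * X ^ 2 +
      C (L.coeff 1 * b + 2 * L.coeff 2 * D b + 3 * L.coeff 3 * D (D b)) * X +
      C (L.coeff 0 * b + L.coeff 1 * D b + L.coeff 2 * D (D b) + L.coeff 3 * D (D (D b))) := by
  rw [opComp, act_of_natDegree_le_three _ _ _ h, dComp_C, dComp_linear, dComp_quadratic]
  simp only [smul_eq_C_mul, map_add, map_mul, map_ofNat]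
  ring

theorem opComp_C_right_of_natDegree_le_two (L : K[X]) (h : L.natDegree ≤ 2) (b : K) :
    opComp D L (C b) =
      C (L.coeff 2 * b) * X ^ 2 + C (L.coeff 1 * b + 2 * L.coeff 2 * D b) * X +
      C (L.coeff 0 * b + L.coeff 1 * D b + L.coeff 2 * D (D b)) := by
  rw [opComp, act_of_natDegree_le_two _ _ _ h, dComp_C, dComp_linear]
  simp only [smul_eq_C_mul, map_add, map_mul, map_ofNat]
  ring

end OperatorComposition

/-- The monic operator `∂³ + 3s ∂² + t ∂ + a₀`, where `a₀` is the value that self-duality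
imposes. -/
def selfDualCubic {K : Type} [Field K] [Algebra ℚ K] (D : Derivation ℚ K K) (s t : K) : K[X] :=
  X ^ 3 + C (3 * s) * X ^ 2 + C t * X +
    C (t * s + D t / 2 - D (D s) / 2 - 3 * s * D s - 2 * s ^ 3)

/-- The monic operator `∂² + c ∂ + d`. -/
def monicQuadratic {K : Type} [Field K] (c d : K) : K[X] := X ^ 2 + C c * X + C d

/-- The symmetric square `∂³ + 3c ∂² + (2c² + c' + 4d) ∂ + (4cd + 2d')` of `∂² + c ∂ + d`. -/
def symSquare {K : Type} [Field K] [Algebra ℚ K] (D : Derivation ℚ K K) (c d : K) : K[X] :=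
  X ^ 3 + C (3 * c) * X ^ 2 + C (2 * c ^ 2 + D c + 4 * d) * X + C (4 * c * d + 2 * D d)

section Coefficients
variable {K : Type} [Field K]

theorem natDegree_cubic (a b c : K) :
    (X ^ 3 + C a * X ^ 2 + C b * X + C c : K[X]).natDegree = 3 := by
  compute_degree!

theorem natDegree_monicQuadratic (c d : K) : (monicQuadratic c d).natDegree = 2 := by
  unfold monicQuadratic
  compute_degree!

theorem coeff_monicQuadratic (c d : K) : (monicQuadratic c d).coeff 0 = d ∧
    (monicQuadratic c d).coeff 1 = c ∧ (monicQuadratic c d).coeff 2 = 1 := by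
  simp [monicQuadratic, coeff_X, coeff_C]

theorem coeff_cubic (a b c d : K) :
    (C a * X ^ 3 + C b * X ^ 2 + C c * X + C d : K[X]).coeff 0 = d ∧
    (C a * X ^ 3 + C b * X ^ 2 + C c * X + C d : K[X]).coeff 1 = c ∧
    (C a * X ^ 3 + C b * X ^ 2 + C c * X + C d : K[X]).coeff 2 = b ∧
    (C a * X ^ 3 + C b * X ^ 2 + C c * X + C d : K[X]).coeff 3 = a := by
  simp [coeff_X, coeff_C]

theorem coeff_C_mul_cubic (l a b c : K) :
    (C l * (X ^ 3 + C a * X ^ 2 + C b * X + C c) : K[X]).coeff 0 = l * c ∧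
    (C l * (X ^ 3 + C a * X ^ 2 + C b * X + C c) : K[X]).coeff 1 = l * b ∧
    (C l * (X ^ 3 + C a * X ^ 2 + C b * X + C c) : K[X]).coeff 2 = l * a ∧
    (C l * (X ^ 3 + C a * X ^ 2 + C b * X + C c) : K[X]).coeff 3 = l := by
  simp [coeff_X, coeff_C, coeff_X_pow]

end Coefficients

theorem dual_of_natDegree_eq_three (L : Qz[X]) (h : L.natDegree = 3) :
    dual L = C (L.coeff 3) * X ^ 3 + C (3 * dz (L.coeff 3) - L.coeff 2) * X ^ 2 +
      C (3 * dz (dz (L.coeff 3)) - 2 * dz (L.coeff 2) + L.coeff 1) * X +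
      C (dz (dz (dz (L.coeff 3))) - dz (dz (L.coeff 2)) + dz (L.coeff 1) - L.coeff 0) := by
  rw [dual, h]
  simp only [Finset.sum_range_succ, Finset.sum_range_zero, Function.iterate_succ_apply',
    Function.iterate_zero_apply, dComp_C, dComp_linear, dComp_quadratic]
  simp only [map_add, map_sub, map_mul, map_ofNat]
  ring

theorem dual_of_natDegree_eq_two (L : Qz[X]) (h : L.natDegree = 2) :
    dual L = C (L.coeff 2) * X ^ 2 + C (2 * dz (L.coeff 2) - L.coeff 1) * X +
      C (dz (dz (L.coeff 2)) - dz (L.coeff 1) + L.coeff 0) := by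
  rw [dual, h]
  simp only [Finset.sum_range_succ, Finset.sum_range_zero, Function.iterate_succ_apply',
    Function.iterate_zero_apply, dComp_C, dComp_linear]
  simp only [map_add, map_sub, map_mul, map_ofNat]
  ring

/-- Self-duality of an operator of order three fixes its coefficient of order zero, and makes
`exp (-2 ∫ s)` a rational function. -/
theorem exists_eq_selfDualCubic (L : Qz[X]) (hdeg : L.natDegree = 3)
    (h : ∃ α : Qz, α ≠ 0 ∧ opComp dz L (C α) = opComp dz (C α) (dual L)) :
    ∃ l s t β : Qz, l ≠ 0 ∧ β ≠ 0 ∧ dz β = -2 * s * β ∧ L = C l * selfDualCubic dz s t := by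
  obtain ⟨α, hα, h⟩ := h
  have hl : L.coeff 3 ≠ 0 := by
    rw [← hdeg]; exact leadingCoeff_ne_zero.mpr (by rintro rfl; simp at hdeg)
  rw [opComp_C_right_of_natDegree_le_three dz L hdeg.le, opComp_C_left,
    dual_of_natDegree_eq_three L hdeg] at h
  have h2 := congrArg (fun p => coeff p 2) h
  have h0 := congrArg (fun p => coeff p 0) h
  simp only [coeff_C_mul, (coeff_cubic _ _ _ _).1, (coeff_cubic _ _ _ _).2.2.1] at h2 h0
  have hL : L = C (L.coeff 3) * X ^ 3 + C (L.coeff 2) * X ^ 2 + C (L.coeff 1) * X +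
      C (L.coeff 0) := by
    conv_lhs => rw [L.as_sum_range_C_mul_X_pow, hdeg]
    simp [Finset.sum_range_succ]
    ring
  generalize L.coeff 3 = l at *
  obtain ⟨s, hs⟩ : ∃ s, L.coeff 2 = 3 * s * l := ⟨L.coeff 2 / (3 * l), by field_simp⟩
  obtain ⟨t, ht⟩ : ∃ t, L.coeff 1 = t * l := ⟨L.coeff 1 / l, by field_simp⟩
  obtain ⟨a, ha⟩ : ∃ a, L.coeff 0 = a * l := ⟨L.coeff 0 / l, by field_simp⟩
  obtain ⟨β, hβ⟩ : ∃ β, α = β * l := ⟨α / l, by field_simp⟩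
  rw [hs, ht, ha] at h0 hL
  rw [hs] at h2
  subst hβ
  have hβ0 : β ≠ 0 := left_ne_zero_of_mul hα
  have hd3 : dz (3 : Qz) = 0 := by simpa using dz.map_natCast 3
  have hd2 : dz (2 : Qz) = 0 := by simpa using dz.map_natCast 2
  have hβ' : dz β = -2 * s * β := by
    have : 3 * l ^ 2 * (dz β - (-2 * s * β)) = 0 := by
      simp only [Derivation.leibniz, smul_eq_mul] at h2
      linear_combination h2
    have := (mul_eq_zero.mp this).resolve_left (by simp [hl])
    exact sub_eq_zero.mp this
  refine ⟨l, s, t, β, hl, hβ0, hβ', ?_⟩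
  have key : a = t * s + dz t / 2 - dz (dz s) / 2 - 3 * s * dz s - 2 * s ^ 3 := by
    have : 2 * β * l ^ 2 * (a - (t * s + dz t / 2 - dz (dz s) / 2 - 3 * s * dz s - 2 * s ^ 3))
        = 0 := by
      have hm2 : dz (-2 : Qz) = 0 := by rw [map_neg, hd2, neg_zero]
      simp only [Derivation.leibniz, smul_eq_mul, map_add, hd3, hβ', hm2, mul_zero,
        add_zero] at h0
      linear_combination h0
    have := (mul_eq_zero.mp this).resolve_left (by simp [hl, hβ0])
    exact sub_eq_zero.mp this
  rw [hL, key, selfDualCubic]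
  simp only [map_mul]
  ring

theorem act_C_mul_selfDualCubic {M : Type} [AddCommGroup M] [Module Qz M] (T : M → M)
    (l s t : Qz) (m : M) : act T (C l * selfDualCubic dz s t) m =
      l • ((t * s + dz t / 2 - dz (dz s) / 2 - 3 * s * dz s - 2 * s ^ 3) • m + t • T m +
        (3 * s) • T (T m) + T (T (T m))) := by
  rw [selfDualCubic, act_of_natDegree_le_three T _ m
    ((natDegree_C_mul_le _ _).trans (natDegree_cubic _ _ _).le),
    (coeff_C_mul_cubic _ _ _ _).1, (coeff_C_mul_cubic _ _ _ _).2.1,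
    (coeff_C_mul_cubic _ _ _ _).2.2.1, (coeff_C_mul_cubic _ _ _ _).2.2.2]
  simp only [smul_add, smul_smul]

theorem act_monicQuadratic {M : Type} [AddCommGroup M] [Module Qz M] (T : M → M)
    (c d : Qz) (m : M) : act T (monicQuadratic c d) m = d • m + c • T m + T (T m) := by
  rw [act_of_natDegree_le_two T _ m (natDegree_monicQuadratic c d).le,
    (coeff_monicQuadratic c d).1, (coeff_monicQuadratic c d).2.1, (coeff_monicQuadratic c d).2.2,
    one_smul]

/-! ### Self-duality and irreducibility of the operator of order two -/

theorem opComp_monicQuadratic_C (c d b : Qz) :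
    opComp dz (monicQuadratic c d) (C b) =
      C b * X ^ 2 + C (c * b + 2 * dz b) * X + C (d * b + c * dz b + dz (dz b)) := by
  rw [opComp_C_right_of_natDegree_le_two dz _ (natDegree_monicQuadratic c d).le,
    (coeff_monicQuadratic c d).1, (coeff_monicQuadratic c d).2.1, (coeff_monicQuadratic c d).2.2]
  simp

/-- An operator of order two is self-dual as soon as `exp (-∫ c)` is a rational function. -/
theorem monicQuadratic_selfDual (c d α : Qz) (h : dz α = -c * α) :
    opComp dz (monicQuadratic c d) (C α) = opComp dz (C α) (dual (monicQuadratic c d)) := by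
  rw [opComp_monicQuadratic_C, opComp_C_left,
    dual_of_natDegree_eq_two _ (natDegree_monicQuadratic c d), (coeff_monicQuadratic c d).1,
    (coeff_monicQuadratic c d).2.1, (coeff_monicQuadratic c d).2.2]
  simp only [h, Derivation.leibniz, Derivation.map_one_eq_zero, map_zero, map_add, map_sub,
    map_mul, map_neg, map_one, smul_eq_mul, map_ofNat]
  ring

/-- A right factor `∂ - ρ` of `∂² + c ∂ + d`, that is a solution `w` with `w' = ρ w`, yields the
solution `w² / g` of the cubic operator, where `g' = (s - c) g`. -/
theorem selfDualCubic_eq_opComp {s t c d ρ : Qz} (hc : dz c = -c ^ 2)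
    (hd : d = (t - 3 * dz s - 3 * s ^ 2) / 4 - c ^ 2 / 4)
    (hρ : dz ρ + ρ ^ 2 + c * ρ + d = 0) (l : Qz) :
    ∃ A B : Qz[X], A.natDegree = 2 ∧ B.natDegree = 1 ∧
      C l * selfDualCubic dz s t = opComp dz (C l * A) B := by
  set τ := 2 * ρ - (s - c) with hτ
  have hd2 : dz (2 : Qz) = 0 := by simpa using dz.map_natCast 2
  have hd3 : dz (3 : Qz) = 0 := by simpa using dz.map_natCast 3
  have hd4 : dz (4 : Qz) = 0 := by simpa using dz.map_natCast 4
  have hz1 : dz (1 : Qz) = 0 := dz.map_one_eq_zero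
  have ht : t = 4 * d + c ^ 2 + 3 * dz s + 3 * s ^ 2 := by rw [hd]; ring
  have hρ' : dz ρ = -(ρ ^ 2 + c * ρ + d) := by linear_combination hρ
  refine ⟨monicQuadratic (3 * s + τ) (t + 3 * s * τ + τ ^ 2 + 2 * dz τ), X - C τ,
    natDegree_monicQuadratic _ _, natDegree_X_sub_C τ, ?_⟩
  rw [opComp, act_of_natDegree_le_two _ _ _
    ((natDegree_C_mul_le _ _).trans (natDegree_monicQuadratic _ _).le)]
  have h1 : (X - C τ : Qz[X]) = C 1 * X + C (-τ) := by simp [sub_eq_add_neg]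
  rw [h1, dComp_linear, dComp_quadratic]
  simp only [coeff_C_mul, (coeff_monicQuadratic _ _).1, (coeff_monicQuadratic _ _).2.1,
    (coeff_monicQuadratic _ _).2.2, smul_eq_C_mul, mul_one, hz1, zero_add]
  simp only [C_mul, mul_assoc, ← mul_add]
  congr 1
  have key : t * s + dz t / 2 - dz (dz s) / 2 - 3 * s * dz s - 2 * s ^ 3 =
      -(dz (dz τ) + (3 * s + τ) * dz τ + (t + 3 * s * τ + τ ^ 2 + 2 * dz τ) * τ) := by
    have e1 : dz τ = -2 * (ρ ^ 2 + c * ρ + d) - dz s - c ^ 2 := by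
      simp only [hτ, map_sub, Derivation.leibniz, hd2, hρ', hc, smul_eq_mul]
      ring
    have e2 : dz (dz τ) = 2 * ((2 * ρ + c) * (ρ ^ 2 + c * ρ + d) + c ^ 2 * ρ - dz d)
        - dz (dz s) + 2 * c ^ 3 := by
      rw [e1]
      simp only [map_sub, map_add, map_neg, Derivation.leibniz, Derivation.leibniz_pow, hd2, hρ',
        hc, smul_eq_mul, nsmul_eq_mul]
      push_cast
      ring
    have e3 : dz t = 4 * dz d - 2 * c ^ 3 + 3 * dz (dz s) + 6 * s * dz s := by
      rw [ht]
      simp only [map_add, Derivation.leibniz, Derivation.leibniz_pow, hd3, hd4, hc, smul_eq_mul,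
        nsmul_eq_mul]
      push_cast
      ring
    rw [e2, e1, e3, ht, hτ]
    ring
  rw [selfDualCubic, key]
  simp only [map_add, map_mul, map_neg, map_ofNat, map_one, map_pow]
  ring

theorem monicQuadratic_isIrreducible {l s t c d : Qz} (hc : dz c = -c ^ 2)
    (hd : d = (t - 3 * dz s - 3 * s ^ 2) / 4 - c ^ 2 / 4)
    (hl : l ≠ 0) (hL : IsIrreducible (C l * selfDualCubic dz s t)) :
    IsIrreducible (monicQuadratic c d) := by
  refine ⟨by rw [natDegree_monicQuadratic]; norm_num, fun A B hAB => ?_⟩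
  by_contra! hne
  have hA0 : A ≠ 0 := by rintro rfl; simp at hne
  have hB0 : B ≠ 0 := by rintro rfl; simp at hne
  have hsum := natDegree_opComp dz hA0 hB0
  rw [← hAB, natDegree_monicQuadratic] at hsum
  have hA : A.natDegree = 1 := by omega
  have hB : B.natDegree = 1 := by omega
  have hb : B.coeff 1 ≠ 0 := by rw [← hB]; exact leadingCoeff_ne_zero.mpr hB0
  have hBe : B = C (B.coeff 1) * X + C (B.coeff 0) := by
    conv_lhs => rw [B.as_sum_range_C_mul_X_pow, hB]
    simp [Finset.sum_range_succ]
    ring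
  rw [opComp, act_of_natDegree_le_one _ _ _ hA.le] at hAB
  generalize hb1 : B.coeff 1 = b1 at hBe hb
  generalize hb0 : B.coeff 0 = b0 at hBe
  rw [hBe, dComp_linear] at hAB
  have hAB' : monicQuadratic c d = C (0 : Qz) * X ^ 3 + C (A.coeff 1 * b1) * X ^ 2 +
      C (A.coeff 1 * (dz b1 + b0) + A.coeff 0 * b1) * X +
        C (A.coeff 1 * dz b0 + A.coeff 0 * b0) := by
    rw [hAB]
    simp only [smul_eq_C_mul, map_add, map_mul, map_zero]
    ring
  have h0 := congrArg (fun p => coeff p 0) hAB'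
  have h1 := congrArg (fun p => coeff p 1) hAB'
  have h2 := congrArg (fun p => coeff p 2) hAB'
  simp only [(coeff_monicQuadratic _ _).1, (coeff_monicQuadratic _ _).2.1,
    (coeff_monicQuadratic _ _).2.2, (coeff_cubic _ _ _ _).1, (coeff_cubic _ _ _ _).2.1,
    (coeff_cubic _ _ _ _).2.2.1] at h0 h1 h2
  -- `B` is a multiple of `∂ - ρ`, and `A ∘ B = P` becomes a Riccati equation for `ρ`
  obtain ⟨ρ, hρ⟩ : ∃ ρ, b0 = -ρ * b1 := ⟨-(b0 / b1), by field_simp⟩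
  have hric : dz ρ + ρ ^ 2 + c * ρ + d = 0 := by
    have hb0' : dz b0 = -(dz ρ * b1 + ρ * dz b1) := by
      rw [hρ, Derivation.leibniz, map_neg, smul_eq_mul, smul_eq_mul]
      ring
    rw [hb0'] at h0
    rw [hρ] at h0 h1
    linear_combination (-(dz ρ)) * (h2.symm) + h0 + ρ * h1 - ρ ^ 2 * h2.symm
  obtain ⟨A', B', hA', hB', hfac⟩ := selfDualCubic_eq_opComp hc hd hric l
  rcases hL.2 _ _ hfac with h | h
  · rw [natDegree_C_mul hl] at h
    omega
  · omega

/-! ### The symmetric square and the twist -/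

section SymmetricSquare

theorem coeff_sum_monomial_dz {σ : Type} (p : MvPolynomial σ Qz) (m : σ →₀ ℕ) :
    (∑ s ∈ p.support, MvPolynomial.monomial s (dz (p.coeff s))).coeff m = dz (p.coeff m) := by
  classical
  rw [MvPolynomial.coeff_sum]
  simp only [MvPolynomial.coeff_monomial, Finset.sum_ite_eq', MvPolynomial.mem_support_iff]
  split_ifs with h
  · rfl
  · rw [not_not.mp h, map_zero]

theorem symD_add (P : Qz[X]) (p q : MvPolynomial (Fin P.natDegree) Qz) :
    symD P (p + q) = symD P p + symD P q := by
  ext m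
  rw [symD, symD, symD, MvPolynomial.coeff_add, MvPolynomial.coeff_add, MvPolynomial.coeff_add,
    MvPolynomial.coeff_add, coeff_sum_monomial_dz, coeff_sum_monomial_dz, coeff_sum_monomial_dz]
  simp only [map_add, add_mul, Finset.sum_add_distrib, MvPolynomial.coeff_add]
  ring

theorem symD_C_mul_X_mul_X (P : Qz[X]) (a : Qz) (i j : Fin P.natDegree) :
    symD P (MvPolynomial.C a * (MvPolynomial.X i * MvPolynomial.X j)) =
      MvPolynomial.C (dz a) * (MvPolynomial.X i * MvPolynomial.X j) +
        MvPolynomial.C a * (nextVar P i * MvPolynomial.X j + MvPolynomial.X i * nextVar P j) := by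
  classical
  rw [symD]
  congr 1
  · ext m
    rw [coeff_sum_monomial_dz, MvPolynomial.coeff_C_mul, MvPolynomial.coeff_C_mul,
      MvPolynomial.X, MvPolynomial.X, MvPolynomial.monomial_mul, MvPolynomial.coeff_monomial]
    split_ifs <;> simp
  · simp [Derivation.leibniz, MvPolynomial.pderiv_X, Pi.single_apply, add_mul, mul_add,
      Finset.sum_add_distrib]
    ring

/-- The square of the class of `1` and its derivatives are linearly independent up to order two,
and the third derivative expresses the symmetric square. -/
theorem isSymPower_two_symSquare {P : Qz[X]} (l c d : Qz) (hl : l ≠ 0)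
    (hP : P = monicQuadratic c d) : IsSymPower 2 P (C l * symSquare dz c d) := by
  have hdeg : P.natDegree = 2 := by rw [hP, natDegree_monicQuadratic]
  have hQ : (symSquare dz c d).natDegree = 3 := natDegree_cubic _ _ _
  have h0 : 0 < P.natDegree := by omega
  have h1 : 1 < P.natDegree := by omega
  have hn0 : nextVar P ⟨0, h0⟩ = MvPolynomial.X ⟨1, h1⟩ := by
    simp [nextVar, h1]
  have hn1 : nextVar P ⟨1, h1⟩ = -(MvPolynomial.C d * MvPolynomial.X ⟨0, h0⟩ +
      MvPolynomial.C c * MvPolynomial.X ⟨1, h1⟩) := by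
    have hm : P.leadingCoeff = 1 := by
      rw [leadingCoeff, hdeg, hP, (coeff_monicQuadratic c d).2.2]
    have e0 : P.coeff 0 = d := by rw [hP, (coeff_monicQuadratic c d).1]
    have e1 : P.coeff 1 = c := by rw [hP, (coeff_monicQuadratic c d).2.1]
    rw [nextVar, dif_neg (by simp [hdeg]), hm]
    congr 1
    have hsum : ∀ g : Fin P.natDegree → MvPolynomial (Fin P.natDegree) Qz,
        ∑ j, g j = g ⟨0, h0⟩ + g ⟨1, h1⟩ := by
      intro g
      rw [← (finCongr hdeg).symm.sum_comp, Fin.sum_univ_two]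
      rfl
    simp [hsum, e0, e1]
  set x := (MvPolynomial.X ⟨0, h0⟩ : MvPolynomial (Fin P.natDegree) Qz) with hx
  set y := (MvPolynomial.X ⟨1, h1⟩ : MvPolynomial (Fin P.natDegree) Qz) with hy
  -- the action of `∂` on the quadratic forms in `x` and `y`
  have hD : ∀ u v w : Qz, symD P (MvPolynomial.C u * (x * x) + MvPolynomial.C v * (x * y) +
      MvPolynomial.C w * (y * y)) =
      MvPolynomial.C (dz u - d * v) * (x * x) +
        MvPolynomial.C (dz v + 2 * u - c * v - 2 * d * w) * (x * y) +
        MvPolynomial.C (dz w + v - 2 * c * w) * (y * y) := by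
    intro u v w
    rw [symD_add, symD_add, symD_C_mul_X_mul_X, symD_C_mul_X_mul_X, symD_C_mul_X_mul_X, hn0, hn1]
    simp only [map_add, map_sub, map_mul, map_ofNat]
    ring
  have hE0 : x ^ 2 = MvPolynomial.C 1 * (x * x) + MvPolynomial.C 0 * (x * y) +
      MvPolynomial.C 0 * (y * y) := by
    simp [pow_two]
  have hd2 : dz (2 : Qz) = 0 := by simpa using dz.map_natCast 2
  have hm2 : dz (-2 : Qz) = 0 := by rw [map_neg, hd2, neg_zero]
  have hE1 : symD P (x ^ 2) = MvPolynomial.C 0 * (x * x) + MvPolynomial.C 2 * (x * y) +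
      MvPolynomial.C 0 * (y * y) := by
    rw [hE0, hD]; simp
  have hE2 : symD P (symD P (x ^ 2)) = MvPolynomial.C (-2 * d) * (x * x) +
      MvPolynomial.C (-2 * c) * (x * y) + MvPolynomial.C 2 * (y * y) := by
    rw [hE1, hD, hd2]
    congr 3 <;> simp <;> ring
  have hE3 : symD P (symD P (symD P (x ^ 2))) =
      MvPolynomial.C (-2 * dz d + 2 * c * d) * (x * x) +
      MvPolynomial.C (-2 * dz c + 2 * c ^ 2 - 8 * d) * (x * y) +
      MvPolynomial.C (-6 * c) * (y * y) := by
    rw [hE2, hD, hd2]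
    simp only [Derivation.leibniz, hm2, smul_eq_mul]
    congr 3 <;> ring_nf
  refine ⟨?_, h0, ?_, ?_⟩
  · apply mul_ne_zero (C_ne_zero.mpr hl)
    intro h; rw [h] at hQ; simp at hQ
  · rw [act_of_natDegree_le_three _ _ _ ((natDegree_C_mul_le _ _).trans hQ.le), hE3, hE2, hE1]
    rw [symSquare, (coeff_C_mul_cubic _ _ _ _).1, (coeff_C_mul_cubic _ _ _ _).2.1,
      (coeff_C_mul_cubic _ _ _ _).2.2.1, (coeff_C_mul_cubic _ _ _ _).2.2.2]
    simp only [MvPolynomial.smul_eq_C_mul, map_add, map_sub, map_mul, map_neg, map_ofNat, map_pow,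
      map_zero]
    ring
  · intro R hR hact
    rw [natDegree_C_mul hl, hQ]
    by_contra! hlt
    rw [act_of_natDegree_le_two _ _ _ (by omega), hE2, hE1] at hact
    -- a vanishing quadratic form is evaluated at `(0, 1)`, `(1, 0)` and `(1, 1)`
    have hev : ∀ u v : Qz, R.coeff 0 * u ^ 2 + R.coeff 1 * (2 * u * v) +
        R.coeff 2 * (-2 * d * u ^ 2 - 2 * c * u * v + 2 * v ^ 2) = 0 := by
      intro u v
      have := congrArg (MvPolynomial.eval fun i : Fin P.natDegree => if i.val = 0 then u else v)
        hact
      simp [hx, hy, MvPolynomial.smul_eval] at this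
      linear_combination this
    have r2 : R.coeff 2 = 0 := by simpa using hev 0 1
    have r0 : R.coeff 0 = 0 := by simpa [r2] using hev 1 0
    have r1 : R.coeff 1 = 0 := by simpa [r2, r0] using hev 1 1
    apply hR
    ext n
    rcases n with _ | _ | _ | n
    · simpa using r0
    · simpa using r1
    · simpa using r2
    · rw [coeff_eq_zero_of_natDegree_lt (by omega), coeff_zero]

end SymmetricSquare

/-- If `g' = (s - c) g` then conjugation by `g` turns the self-dual cubic operator into a
symmetric square. -/
theorem tensorFun_selfDualCubic {s t c d l : Qz} (hc : dz c = -c ^ 2)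
    (hd : d = (t - 3 * dz s - 3 * s ^ 2) / 4 - c ^ 2 / 4) {g : Qalg} (hg : g ≠ 0)
    (hg' : dalg g = algebraMap Qz Qalg (s - c) * g) :
    tensorFun ((C l * selfDualCubic dz s t).map (algebraMap Qz Qalg)) g =
      (C l * symSquare dz c d).map (algebraMap Qz Qalg) := by
  obtain ⟨k, hk⟩ : ∃ k, k = g⁻¹ := ⟨_, rfl⟩
  have hgk : g * k = 1 := by rw [hk, mul_inv_cancel₀ hg]
  have hd3 : dz (3 : Qz) = 0 := by simpa using dz.map_natCast 3
  have hd4 : dz (4 : Qz) = 0 := by simpa using dz.map_natCast 4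
  have hk1 : dalg k = algebraMap Qz Qalg (c - s) * k := by
    rw [hk, Derivation.leibniz_inv, hg']
    simp only [smul_eq_mul, map_sub]
    field_simp
    ring
  have hk2 : dalg (dalg k) = algebraMap Qz Qalg ((c - s) ^ 2 - c ^ 2 - dz s) * k := by
    rw [hk1, Derivation.leibniz, dalg_algebraMap, hk1]
    simp only [smul_eq_mul, map_sub, map_pow, map_neg, hc]
    ring
  have hk3 : dalg (dalg (dalg k)) = algebraMap Qz Qalg (((c - s) ^ 2 - c ^ 2 - dz s) * (c - s) +
      2 * (c - s) * (-c ^ 2 - dz s) + 2 * c ^ 3 - dz (dz s)) * k := by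
    rw [hk2, Derivation.leibniz, dalg_algebraMap, hk1]
    simp only [Derivation.leibniz_pow, smul_eq_mul, map_sub, map_add, map_mul, map_pow, map_neg, hc,
      nsmul_eq_mul]
    push_cast
    simp only [map_ofNat]
    ring
  have ht : t = 4 * d + c ^ 2 + 3 * dz s + 3 * s ^ 2 := by rw [hd]; ring
  have ht' : dz t = 4 * dz d - 2 * c ^ 3 + 3 * dz (dz s) + 6 * s * dz s := by
    rw [ht]
    simp only [map_add, Derivation.leibniz, Derivation.leibniz_pow, hd3, hd4, hc, smul_eq_mul,
      nsmul_eq_mul]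
    push_cast
    ring
  have hS : selfDualCubic dz s t = X ^ 3 + C (3 * s) * X ^ 2 +
      C (4 * d + c ^ 2 + 3 * dz s + 3 * s ^ 2) * X +
        C (4 * d * s + c ^ 2 * s + 3 * s * dz s + s ^ 3 + 2 * dz d - c ^ 3 + dz (dz s)) := by
    rw [selfDualCubic, ht', ← ht]
    congr 2
    rw [ht]
    ring
  rw [tensorFun, ← hk, opComp_C_left, opComp_C_right_of_natDegree_le_three]
  · simp only [coeff_map]
    rw [hS, (coeff_C_mul_cubic _ _ _ _).1, (coeff_C_mul_cubic _ _ _ _).2.1,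
      (coeff_C_mul_cubic _ _ _ _).2.2.1, (coeff_C_mul_cubic _ _ _ _).2.2.2, hk3, hk2, hk1,
      symSquare, hc]
    have hC : C g * C k = (1 : Qalg[X]) := by rw [← C_mul, hgk, C_1]
    simp only [Polynomial.map_mul, Polynomial.map_add, Polynomial.map_pow, map_X, map_C]
    simp only [map_sub, map_add, map_mul, map_pow, map_neg, map_ofNat]
    linear_combination (C (algebraMap Qz Qalg l) * (X ^ 3 + 3 * C (algebraMap Qz Qalg c) * X ^ 2 +
      (C (algebraMap Qz Qalg c) ^ 2 + 4 * C (algebraMap Qz Qalg d)) * X +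
      (4 * C (algebraMap Qz Qalg c) * C (algebraMap Qz Qalg d) +
        2 * C (algebraMap Qz Qalg (dz d))))) * hC
  · refine (natDegree_map_le).trans ((natDegree_C_mul_le _ _).trans (natDegree_cubic _ _ _).le)

theorem dz_ratFunc_X : dz RatFunc.X = 1 := by
  rw [← RatFunc.algebraMap_X, dz_algebraMap, derivative_X, map_one]

theorem dz_inv_X : dz (RatFunc.X : Qz)⁻¹ = -((RatFunc.X : Qz)⁻¹) ^ 2 := by
  rw [Derivation.leibniz_inv, dz_ratFunc_X]
  simp

/-- The twisting function `g = (β z²)^(-1/2)`, for which `g' / g = s - 1 / z`. -/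
theorem exists_twist {s β : Qz} (hβ0 : β ≠ 0) (hβ : dz β = -2 * s * β) :
    ∃ g : Qalg, g ≠ 0 ∧ dalg g = algebraMap Qz Qalg (s - (RatFunc.X : Qz)⁻¹) * g := by
  have hX : (RatFunc.X : Qz) ≠ 0 := RatFunc.X_ne_zero
  set γ : Qz := (β * RatFunc.X ^ 2)⁻¹ with hγ
  have hγ0 : γ ≠ 0 := inv_ne_zero (mul_ne_zero hβ0 (pow_ne_zero _ hX))
  have hγ' : dz γ = 2 * (s - (RatFunc.X : Qz)⁻¹) * γ := by
    rw [hγ, Derivation.leibniz_inv, Derivation.leibniz, Derivation.leibniz_pow, hβ, dz_ratFunc_X]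
    simp only [smul_eq_mul, nsmul_eq_mul]
    push_cast
    field_simp
    ring
  obtain ⟨g, hg⟩ := IsAlgClosed.exists_pow_nat_eq (algebraMap Qz Qalg γ) (n := 2) (by norm_num)
  have hg0 : g ≠ 0 := by
    rintro rfl
    rw [zero_pow two_ne_zero, eq_comm, map_eq_zero] at hg
    exact hγ0 hg
  refine ⟨g, hg0, ?_⟩
  have h := congrArg dalg hg
  rw [dalg_algebraMap, hγ', Derivation.leibniz_pow, map_mul, map_mul, ← hg, map_ofNat] at h
  simp only [smul_eq_mul, nsmul_eq_mul] at h
  generalize algebraMap Qz Qalg (s - (RatFunc.X : Qz)⁻¹) = e at h ⊢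
  push_cast at h
  apply mul_left_cancel₀ (mul_ne_zero (two_ne_zero (α := Qalg)) hg0)
  linear_combination h

/-! ### N-integral power series -/

section NIntegral

theorem nIntegral_iff_exists_rescale (f : PowerSeries ℚ) :
    NIntegral f ↔ ∃ N : ℕ, 0 < N ∧ ∃ g : PowerSeries ℤ,
      PowerSeries.rescale (N : ℚ) f = g.map (Int.castRingHom ℚ) := by
  refine exists_congr fun N => and_congr_right fun _ => ⟨fun h => ?_, ?_⟩
  · choose a ha using h
    refine ⟨PowerSeries.mk a, ?_⟩
    ext m
    simp [PowerSeries.coeff_rescale, ha]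
  · rintro ⟨g, hg⟩ m
    refine ⟨PowerSeries.coeff m g, ?_⟩
    have := congrArg (PowerSeries.coeff m) hg
    simpa [PowerSeries.coeff_rescale] using this

theorem rescale_map_intCast (N : ℕ) (g : PowerSeries ℤ) :
    PowerSeries.rescale (N : ℚ) (g.map (Int.castRingHom ℚ)) =
      (PowerSeries.rescale (N : ℤ) g).map (Int.castRingHom ℚ) := by
  ext m
  simp [PowerSeries.coeff_rescale]

theorem NIntegral.mul {f g : PowerSeries ℚ} (hf : NIntegral f) (hg : NIntegral g) :
    NIntegral (f * g) := by
  rw [nIntegral_iff_exists_rescale] at *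
  obtain ⟨N, hN, F, hF⟩ := hf
  obtain ⟨M, hM, G, hG⟩ := hg
  refine ⟨N * M, Nat.mul_pos hN hM,
    PowerSeries.rescale (M : ℤ) F * PowerSeries.rescale (N : ℤ) G, ?_⟩
  rw [map_mul, map_mul, ← rescale_map_intCast, ← rescale_map_intCast, ← hF, ← hG,
    PowerSeries.rescale_rescale, PowerSeries.rescale_rescale]
  push_cast
  rw [mul_comm (M : ℚ)]

theorem NIntegral.of_mul_eq_one {f g : PowerSeries ℚ} (hf : NIntegral f)
    (h0 : PowerSeries.constantCoeff f = 1) (h : f * g = 1) : NIntegral g := by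
  rw [nIntegral_iff_exists_rescale] at *
  obtain ⟨N, hN, F, hF⟩ := hf
  have hF0 : PowerSeries.constantCoeff F = 1 := by
    have := congrArg (PowerSeries.coeff 0) hF
    simp [PowerSeries.coeff_rescale, h0] at this
    exact_mod_cast this.symm
  obtain ⟨G, hG⟩ := (PowerSeries.isUnit_iff_constantCoeff.mpr (hF0 ▸ isUnit_one)).exists_right_inv
  refine ⟨N, hN, G, ?_⟩
  have h1 := congrArg (PowerSeries.rescale (N : ℚ)) h
  have h2 := congrArg (PowerSeries.map (Int.castRingHom ℚ)) hG
  rw [map_mul, map_one] at h1 h2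
  rw [← hF] at h2
  exact left_inv_eq_right_inv (by rw [mul_comm]; exact h1) h2

/-- If `t + t² = x` and `t` has no constant term, then the coefficients of `t` are integral
polynomials in those of `x`. -/
theorem coeff_mem_range_of_add_sq {t : PowerSeries ℚ} {x : PowerSeries ℤ}
    (h0 : PowerSeries.constantCoeff t = 0) (h : t + t ^ 2 = x.map (Int.castRingHom ℚ)) (m : ℕ) :
    PowerSeries.coeff m t ∈ (Int.castRingHom ℚ).range := by
  induction m using Nat.strong_induction_on with
  | _ m ih =>
    have hm := congrArg (PowerSeries.coeff m) h
    rw [map_add, PowerSeries.coeff_map, pow_two, PowerSeries.coeff_mul] at hm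
    rw [eq_sub_of_add_eq hm]
    refine sub_mem ⟨_, rfl⟩ (sum_mem fun p hp => ?_)
    rw [Finset.HasAntidiagonal.mem_antidiagonal] at hp
    rcases Nat.eq_zero_or_pos p.1 with h1 | h1
    · rw [h1, PowerSeries.coeff_zero_eq_constantCoeff_apply, h0, zero_mul]
      exact zero_mem _
    rcases Nat.eq_zero_or_pos p.2 with h2 | h2
    · rw [h2, PowerSeries.coeff_zero_eq_constantCoeff_apply, h0, mul_zero]
      exact zero_mem _
    · exact mul_mem (ih _ (by omega)) (ih _ (by omega))

/-- After the substitution of `4z` for `z`, the square root is `1 + 2t` with `t` integral. -/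
theorem NIntegral.of_sq {w : PowerSeries ℚ} (hf : NIntegral (w ^ 2))
    (h0 : PowerSeries.constantCoeff w = 1) : NIntegral w := by
  rw [nIntegral_iff_exists_rescale] at hf
  obtain ⟨N, hN, F, hF⟩ := hf
  refine ⟨4 * N, by omega, ?_⟩
  set t : PowerSeries ℚ := PowerSeries.C (1 / 2 : ℚ) *
    (PowerSeries.rescale ((4 * N : ℕ) : ℚ) w - 1) with ht
  have hw : PowerSeries.rescale ((4 * N : ℕ) : ℚ) w = 1 + 2 * t := by
    have : (2 : PowerSeries ℚ) * PowerSeries.C (1 / 2 : ℚ) = 1 := by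
      rw [← map_ofNat (PowerSeries.C (R := ℚ)) 2, ← map_mul]; norm_num
    rw [ht]
    linear_combination (1 - PowerSeries.rescale ((4 * N : ℕ) : ℚ) w) * this
  have ht0 : PowerSeries.constantCoeff t = 0 := by
    rw [ht, map_mul, map_sub, ← PowerSeries.coeff_zero_eq_constantCoeff_apply
      (PowerSeries.rescale _ w), PowerSeries.coeff_rescale]
    simp [h0]
  obtain ⟨x, hx⟩ : ∃ x : PowerSeries ℤ, t + t ^ 2 = x.map (Int.castRingHom ℚ) := by
    have h1 : PowerSeries.rescale (4 : ℚ) (F.map (Int.castRingHom ℚ)) = (1 + 2 * t) ^ 2 := by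
      rw [← hw, ← hF, PowerSeries.rescale_rescale, map_pow]
      push_cast
      rw [mul_comm]
    refine ⟨PowerSeries.mk fun m => if m = 0 then 0 else 4 ^ (m - 1) * PowerSeries.coeff m F, ?_⟩
    ext m
    have hm := congrArg (PowerSeries.coeff m) h1
    rw [show (1 + 2 * t) ^ 2 = 1 + PowerSeries.C (4 : ℚ) * (t + t ^ 2) by
      rw [map_ofNat]; ring] at hm
    rw [map_add, PowerSeries.coeff_C_mul, PowerSeries.coeff_rescale, PowerSeries.coeff_map,
      PowerSeries.coeff_one] at hm
    rcases m with _ | m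
    · simp [ht0]
    · simp [pow_succ] at hm ⊢
      linarith
  intro m
  obtain ⟨a, ha⟩ := coeff_mem_range_of_add_sq ht0 hx m
  have hm := congrArg (PowerSeries.coeff m) hw
  rw [PowerSeries.coeff_rescale, map_add, ← map_ofNat (PowerSeries.C (R := ℚ)) 2,
    PowerSeries.coeff_C_mul, ← ha, PowerSeries.coeff_one] at hm
  refine ⟨(if m = 0 then 1 else 0) + 2 * a, ?_⟩
  rw [hm]
  push_cast
  rfl

theorem nIntegral_coe_polynomial {p : ℚ[X]} (h0 : p.coeff 0 = 1) :
    NIntegral (p : PowerSeries ℚ) := by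
  refine ⟨∏ i ∈ p.support, (p.coeff i).den, Finset.prod_pos fun i _ => (p.coeff i).den_pos,
    fun m => ?_⟩
  rw [Polynomial.coeff_coe]
  rcases m with _ | m
  · exact ⟨1, by simp [h0]⟩
  by_cases hm : m + 1 ∈ p.support
  · obtain ⟨k, hk⟩ := Finset.dvd_prod_of_mem (fun i => (p.coeff i).den) hm
    refine ⟨(∏ i ∈ p.support, (p.coeff i).den : ℕ) ^ m * k * (p.coeff (m + 1)).num, ?_⟩
    have hd := Rat.mul_den_eq_num (p.coeff (m + 1))
    rw [pow_succ]
    push_cast at *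
    rw [← hd]
    have hk' : (∏ i ∈ p.support, ((p.coeff i).den : ℚ)) = (p.coeff (m + 1)).den * k := by
      exact_mod_cast hk
    rw [mul_assoc]
    nth_rewrite 2 [hk']
    ring
  · exact ⟨0, by simp [notMem_support_iff.mp hm]⟩

/-- The leading coefficient of an N-integral series can be divided out: with `a = N ^ n c`, an
integer, `N |a|` works for `u`. -/
theorem NIntegral.of_C_mul_X_pow_mul {c : ℚ} {n : ℕ} {u : PowerSeries ℚ} (hc : c ≠ 0)
    (h0 : PowerSeries.constantCoeff u = 1)
    (h : NIntegral (PowerSeries.C c * PowerSeries.X ^ n * u)) : NIntegral u := by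
  obtain ⟨N, hN, h⟩ := h
  have hco : ∀ m, PowerSeries.coeff (m + n) (PowerSeries.C c * PowerSeries.X ^ n * u) =
      c * PowerSeries.coeff m u := by
    intro m
    rw [mul_assoc, PowerSeries.coeff_C_mul, PowerSeries.coeff_X_pow_mul]
  obtain ⟨a, ha⟩ := h (0 + n)
  rw [hco, PowerSeries.coeff_zero_eq_constantCoeff_apply, h0, mul_one, zero_add] at ha
  have ha0 : a ≠ 0 := by
    rintro rfl
    simp [hc, hN.ne'] at ha
  obtain ⟨k, ε, hk0, hk⟩ : ∃ (k : ℕ) (ε : ℤ), 0 < k ∧ (k : ℤ) = a * ε := by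
    rcases Int.natAbs_eq a with h | h
    · exact ⟨a.natAbs, 1, by omega, by omega⟩
    · exact ⟨a.natAbs, -1, by omega, by omega⟩
  have hkQ : (k : ℚ) = a * ε := by exact_mod_cast hk
  refine ⟨N * k, Nat.mul_pos hN hk0, fun m => ?_⟩
  rcases m with _ | m
  · exact ⟨1, by simp [h0]⟩
  obtain ⟨b, hb⟩ := h (m + 1 + n)
  rw [hco, pow_add] at hb
  have hb' : (N : ℚ) ^ (m + 1) * PowerSeries.coeff (m + 1) u * a = b := by
    rw [← hb, ← ha]; ring
  refine ⟨b * ε * k ^ m, ?_⟩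
  push_cast
  rw [mul_pow, pow_succ (k : ℚ), ← hb']
  nth_rewrite 2 [hkQ]
  ring

theorem exists_sq_eq {f : PowerSeries ℚ} (h0 : PowerSeries.constantCoeff f = 1) :
    ∃ w : PowerSeries ℚ, PowerSeries.constantCoeff w = 1 ∧ w ^ 2 = f := by
  have hs : PowerSeries.HasSubst (f - 1) :=
    PowerSeries.HasSubst.of_constantCoeff_zero' (by simp [h0])
  set B := PowerSeries.binomialSeries ℚ (1 / 2 : ℚ) with hB
  have hB2 : B ^ 2 = 1 + PowerSeries.X := by
    rw [hB, pow_two, ← PowerSeries.binomialSeries_add]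
    have := PowerSeries.binomialSeries_nat (R := ℚ) (A := ℚ) 1
    norm_num at this ⊢
    exact this
  have hw : (B.subst (f - 1) : PowerSeries ℚ) ^ 2 = f := by
    rw [← PowerSeries.subst_pow hs, hB2, PowerSeries.subst_add hs, PowerSeries.subst_X hs,
      ← PowerSeries.coe_substAlgHom hs, map_one, add_sub_cancel]
  have h1 := congrArg PowerSeries.constantCoeff hw
  rw [map_pow, h0, sq_eq_one_iff] at h1
  rcases h1 with h1 | h1
  · exact ⟨_, h1, hw⟩
  · exact ⟨-_, by rw [map_neg, h1, neg_neg], by rw [neg_sq, hw]⟩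

end NIntegral

/-! ### Differentiation of Laurent series -/

section Laurent

/-- Multiplication by `z` turns the derivative of Laurent series into `∑ aₙ zⁿ ↦ ∑ n aₙ zⁿ`. -/
theorem coeff_single_mul_derivative (f : LaurentSeries ℚ) (n : ℤ) :
    (HahnSeries.single 1 1 * LaurentSeries.derivative ℚ f).coeff n = n * f.coeff n := by
  have := HahnSeries.coeff_single_mul_add (r := (1 : ℚ)) (x := LaurentSeries.derivative ℚ f)
    (a := n - 1) (b := 1)
  rw [sub_add_cancel] at this
  rw [this]
  simp

theorem single_one_ne_zero : (HahnSeries.single 1 1 : LaurentSeries ℚ) ≠ 0 := by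
  simp

theorem derivative_mul (f g : LaurentSeries ℚ) : LaurentSeries.derivative ℚ (f * g) =
    f * LaurentSeries.derivative ℚ g + g * LaurentSeries.derivative ℚ f := by
  apply mul_left_cancel₀ single_one_ne_zero
  have hsupp : ∀ h : LaurentSeries ℚ,
      (HahnSeries.single 1 1 * LaurentSeries.derivative ℚ h).support ⊆ h.support := by
    intro h n hn
    rw [HahnSeries.mem_support, coeff_single_mul_derivative] at hn
    exact right_ne_zero_of_mul hn
  have e : HahnSeries.single 1 1 *
      (f * LaurentSeries.derivative ℚ g + g * LaurentSeries.derivative ℚ f) =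
      f * (HahnSeries.single 1 1 * LaurentSeries.derivative ℚ g) +
      (HahnSeries.single 1 1 * LaurentSeries.derivative ℚ f) * g := by ring
  rw [e]
  ext n
  rw [coeff_single_mul_derivative, HahnSeries.coeff_add, HahnSeries.coeff_mul,
    HahnSeries.coeff_mul_left' f.isPWO_support (hsupp f),
    HahnSeries.coeff_mul_right' g.isPWO_support (hsupp g), ← Finset.sum_add_distrib,
    Finset.mul_sum]
  refine Finset.sum_congr rfl fun p hp => ?_
  rw [coeff_single_mul_derivative, coeff_single_mul_derivative]
  rw [Finset.mem_antidiagonal] at hp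
  rw [← hp.2.2]
  push_cast
  ring

/-- `d/dz` on `ℚ((z))`, as an additive map. It is not bundled as a `Derivation` over `ℚ`, because the
`ℚ`-module structures of `ℚ((z))` found by instance search are not definitionally equal. -/
def derLaurent : LaurentSeries ℚ →+ LaurentSeries ℚ :=
  (LaurentSeries.derivative ℚ).toAddMonoidHom

theorem coe_derLaurent : (derLaurent : LaurentSeries ℚ → LaurentSeries ℚ) =
    LaurentSeries.derivative ℚ := rfl

theorem derLaurent_mul (f g : LaurentSeries ℚ) :
    derLaurent (f * g) = f * derLaurent g + g * derLaurent f :=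
  derivative_mul f g

theorem coeff_derLaurent (f : LaurentSeries ℚ) (n : ℤ) :
    (derLaurent f).coeff n = (n + 1) * f.coeff (n + 1) := by
  simp [coe_derLaurent]

theorem derLaurent_ofPowerSeries (f : PowerSeries ℚ) :
    derLaurent (HahnSeries.ofPowerSeries ℤ ℚ f) =
      HahnSeries.ofPowerSeries ℤ ℚ (PowerSeries.derivative ℚ f) := by
  ext n
  rw [coeff_derLaurent, PowerSeries.coeff_coe, PowerSeries.coeff_coe]
  rcases lt_trichotomy n (-1) with h | rfl | h
  · rw [if_pos (by omega), if_pos (by omega), mul_zero]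
  · simp
  · obtain ⟨m, rfl⟩ := Int.eq_ofNat_of_zero_le (show 0 ≤ n by omega)
    rw [if_neg (by omega), if_neg (by omega), PowerSeries.coeff_derivative]
    simp [show ((m : ℤ) + 1).natAbs = m + 1 by omega, mul_comm]

theorem laurent_algebraMap_polynomial (p : ℚ[X]) :
    algebraMap Qz (LaurentSeries ℚ) (algebraMap ℚ[X] Qz p) =
      HahnSeries.ofPowerSeries ℤ ℚ (p : PowerSeries ℚ) := by
  rw [← IsScalarTower.algebraMap_apply ℚ[X] Qz (LaurentSeries ℚ),
    Polynomial.algebraMap_hahnSeries_apply]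

theorem derLaurent_algebraMap (a : Qz) :
    derLaurent (algebraMap Qz (LaurentSeries ℚ) a) = algebraMap Qz (LaurentSeries ℚ) (dz a) := by
  have hpol : ∀ p : ℚ[X], derLaurent (algebraMap Qz (LaurentSeries ℚ) (algebraMap ℚ[X] Qz p)) =
      algebraMap Qz (LaurentSeries ℚ) (dz (algebraMap ℚ[X] Qz p)) := by
    intro p
    rw [dz_algebraMap, laurent_algebraMap_polynomial, laurent_algebraMap_polynomial,
      derLaurent_ofPowerSeries, PowerSeries.derivative_coe]
  have hq : algebraMap ℚ[X] Qz a.denom ≠ 0 := by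
    simpa using a.denom_ne_zero
  have ha : a * algebraMap ℚ[X] Qz a.denom = algebraMap ℚ[X] Qz a.num := by
    nth_rewrite 1 [← RatFunc.num_div_denom a]
    rw [div_mul_cancel₀ _ hq]
  have h1 := congrArg (fun b => algebraMap Qz (LaurentSeries ℚ) (dz b)) ha
  have h2 := congrArg (fun b => derLaurent (algebraMap Qz (LaurentSeries ℚ) b)) ha
  simp only [Derivation.leibniz, derLaurent_mul, map_add, map_mul, smul_eq_mul, hpol] at h1 h2
  rw [← h1] at h2
  have hq' : algebraMap Qz (LaurentSeries ℚ) (algebraMap ℚ[X] Qz a.denom) ≠ 0 := by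
    simpa using hq
  exact mul_left_cancel₀ hq' (add_left_cancel h2)

theorem eq_C_of_derLaurent_eq_zero {x : LaurentSeries ℚ} (h : derLaurent x = 0) :
    x = HahnSeries.C (x.coeff 0) := by
  ext n
  rw [HahnSeries.C_apply, HahnSeries.coeff_single]
  split_ifs with hn
  · rw [hn]
  · have := congrArg (fun y => y.coeff (n - 1)) h
    simp only [coeff_derLaurent, HahnSeries.coeff_zero, sub_add_cancel] at this
    push_cast at this
    rw [sub_add_cancel] at this
    exact (mul_eq_zero.mp this).resolve_left (by exact_mod_cast hn)

theorem exists_ofPowerSeries_eq {x : LaurentSeries ℚ} (h : ∀ m : ℤ, m < 0 → x.coeff m = 0) :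
    ∃ f : PowerSeries ℚ, HahnSeries.ofPowerSeries ℤ ℚ f = x := by
  refine ⟨PowerSeries.mk fun n => x.coeff n, ?_⟩
  ext n
  rw [PowerSeries.coeff_coe]
  split_ifs with hn
  · rw [h n hn]
  · obtain ⟨m, rfl⟩ := Int.eq_ofNat_of_zero_le (not_lt.mp hn)
    simp

theorem coeff_zero_ofPowerSeries (f : PowerSeries ℚ) :
    (HahnSeries.ofPowerSeries ℤ ℚ f).coeff 0 = PowerSeries.constantCoeff f := by
  simp [PowerSeries.coeff_coe]

instance charZero_laurentSeries : CharZero (LaurentSeries ℚ) :=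
  charZero_of_injective_ringHom (f := HahnSeries.C) HahnSeries.C_injective

end Laurent

/-! ### Identities in differential fields -/

section DifferentialFields

variable {K : Type} [Field K] {D : K →+ K}

theorem leibniz_natCast (hD : ∀ a b, D (a * b) = a * D b + b * D a) (n : ℕ) : D n = 0 := by
  have h1 : D 1 = 0 := by
    have := hD 1 1
    simp only [one_mul] at this
    linear_combination -this
  rw [← nsmul_one, map_nsmul, h1, nsmul_zero]

theorem leibniz_pow (hD : ∀ a b, D (a * b) = a * D b + b * D a) (a : K) (n : ℕ) :
    D (a ^ n) = n * a ^ (n - 1) * D a := by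
  induction n with
  | zero => simpa using leibniz_natCast hD 1
  | succ n ih =>
    rw [pow_succ, hD, ih, Nat.add_sub_cancel]
    rcases n with _ | n
    · simp
    · rw [Nat.add_sub_cancel]; push_cast; ring

/-- If `k w²` solves the self-dual cubic operator, where `k' = (c - s) k`, then the value `E` of
`∂² + c ∂ + d` at `w` satisfies `w E' + 3 w' E + 2 c w E = 0`: up to the factor `2 k`, the left hand
side is the cubic operator applied to `k w²`. With `c = 1 / z` this says that `z² w³ E` is
constant. -/
theorem derivation_sq_mul_cube_mul_eq_zero (hD : ∀ a b, D (a * b) = a * D b + b * D a)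
    [CharZero K] {z c s t d k w E : K}
    (hz : D z = 1) (hcz : c * z = 1) (hk0 : k ≠ 0) (hk : D k = (c - s) * k)
    (hd : t = 4 * d + c ^ 2 + 3 * D s + 3 * s ^ 2) (hE : D (D w) + c * D w + d * w = E)
    (hy : D (D (D (k * w ^ 2))) + 3 * s * D (D (k * w ^ 2)) + t * D (k * w ^ 2) +
      (t * s + D t / 2 - D (D s) / 2 - 3 * s * D s - 2 * s ^ 3) * (k * w ^ 2) = 0) :
    D (z ^ 2 * w ^ 3 * E) = 0 := by
  have hD2 : D (2 : K) = 0 := leibniz_natCast hD 2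
  have hD3 : D (3 : K) = 0 := leibniz_natCast hD 3
  have hD4 : D (4 : K) = 0 := leibniz_natCast hD 4
  have hz0 : z ≠ 0 := right_ne_zero_of_mul_eq_one hcz
  have hc : D c = -c ^ 2 := by
    have h := congrArg D hcz
    have h1 : D 1 = 0 := by simpa using leibniz_natCast hD 1
    rw [hD, hz, h1] at h
    have : z * (D c + c ^ 2) = 0 := by linear_combination h + c * hcz
    linear_combination (mul_eq_zero.mp this).resolve_left hz0
  have ht : D t = 4 * D d - 2 * c ^ 3 + 3 * D (D s) + 6 * s * D s := by
    rw [hd]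
    simp only [map_add, hD, hD3, hD4, hc, pow_two]
    ring
  have hw2 : D (D w) = E - c * D w - d * w := by rw [← hE]; ring
  have hw3 : D (D (D w)) = D E + c ^ 2 * D w - c * (E - c * D w - d * w) - d * D w - w * D d := by
    rw [hw2]
    simp only [map_sub, hD, hc, hw2]
    ring
  have hy1 : D (k * w ^ 2) = k * ((c - s) * w ^ 2 + 2 * w * D w) := by
    simp only [hD, pow_two, hk]; ring
  have hy2 : D (D (k * w ^ 2)) = k * ((c - s) * ((c - s) * w ^ 2 + 2 * w * D w) +
      ((-c ^ 2 - D s) * w ^ 2 + (c - s) * 2 * w * D w + 2 * D w ^ 2 + 2 * w * D (D w))) := by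
    rw [hy1]
    simp only [hD, pow_two, hk, map_add, map_sub, hc, hD2]; ring
  have hy3 : D (D (D (k * w ^ 2))) = k * ((c - s) * ((c - s) * ((c - s) * w ^ 2 + 2 * w * D w) +
      ((-c ^ 2 - D s) * w ^ 2 + (c - s) * 2 * w * D w + 2 * D w ^ 2 + 2 * w * D (D w))) +
      ((-c ^ 2 - D s) * ((c - s) * w ^ 2 + 2 * w * D w) +
        (c - s) * ((-c ^ 2 - D s) * w ^ 2 + (c - s) * 2 * w * D w + 2 * D w ^ 2 + 2 * w * D (D w)) +
      ((2 * c ^ 3 - D (D s)) * w ^ 2 + (-c ^ 2 - D s) * 4 * w * D w +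
        (c - s) * 2 * (D w ^ 2 + w * D (D w)) + 6 * D w * D (D w) + 2 * w * D (D (D w))))) := by
    rw [hy2]
    simp only [hD, pow_two, hk, map_add, map_sub, map_neg, hc, hD2]; ring
  rw [hy3, hy2, hy1, hw3, hw2, ht, hd] at hy
  have key : w * D E + 3 * D w * E + 2 * c * w * E = 0 := by
    have : 2 * k * (w * D E + 3 * D w * E + 2 * c * w * E) = 0 := by linear_combination hy
    exact (mul_eq_zero.mp this).resolve_left (mul_ne_zero two_ne_zero hk0)
  rw [hD, hD, leibniz_pow hD, leibniz_pow hD, hz]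
  push_cast
  linear_combination z ^ 2 * w ^ 2 * key - 2 * z * w ^ 3 * E * hcz

/-- If `k w²` and `k w² τ` solve the self-dual cubic operator and `w` solves `∂² + c ∂ + d`, with
`c = 1 / z`, then `κ = z w² τ'` satisfies `(z w² κ')' = 0`. Here `σ` stands for `τ'`. -/
theorem derivation_mul_derivation_eq_zero (hD : ∀ a b, D (a * b) = a * D b + b * D a)
    {z c s t d k w σ : K}
    (hz : D z = 1) (hcz : c * z = 1) (hk0 : k ≠ 0) (hk : D k = (c - s) * k)
    (hd : t = 4 * d + c ^ 2 + 3 * D s + 3 * s ^ 2) (hw : D (D w) + c * D w + d * w = 0)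
    (hσ : 3 * D (D (k * w ^ 2)) * σ + 3 * D (k * w ^ 2) * D σ + k * w ^ 2 * D (D σ) +
      3 * s * (2 * D (k * w ^ 2) * σ + k * w ^ 2 * D σ) + t * (k * w ^ 2 * σ) = 0) :
    D (z * w ^ 2 * D (z * w ^ 2 * σ)) = 0 := by
  have hD2 : D (2 : K) = 0 := leibniz_natCast hD 2
  have h1 : D (1 : K) = 0 := by simpa using leibniz_natCast hD 1
  have hz0 : z ≠ 0 := right_ne_zero_of_mul_eq_one hcz
  have hc : D c = -c ^ 2 := by
    have h := congrArg D hcz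
    rw [hD, hz, h1] at h
    have : z * (D c + c ^ 2) = 0 := by linear_combination h + c * hcz
    linear_combination (mul_eq_zero.mp this).resolve_left hz0
  have hw2 : D (D w) = - c * D w - d * w := by linear_combination hw
  have hy1 : D (k * w ^ 2) = k * ((c - s) * w ^ 2 + 2 * w * D w) := by
    simp only [hD, pow_two, hk]; ring
  have hy2 : D (D (k * w ^ 2)) = k * ((c - s) * ((c - s) * w ^ 2 + 2 * w * D w) +
      ((-c ^ 2 - D s) * w ^ 2 + (c - s) * 2 * w * D w + 2 * D w ^ 2 + 2 * w * D (D w))) := by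
    rw [hy1]
    simp only [hD, pow_two, hk, map_add, map_sub, hc, hD2]; ring
  rw [hy2, hy1, hw2, hd] at hσ
  have hκ : D (z * w ^ 2 * σ) = w * (w * σ + 2 * z * D w * σ + z * w * D σ) := by
    simp only [hD, pow_two, hz]; ring
  rw [hκ]
  have e : D (z * w ^ 2 * (w * (w * σ + 2 * z * D w * σ + z * w * D σ))) =
      z * w ^ 2 * (w * (3 * D w * σ + 2 * w * D σ + 2 * z * D (D w) * σ + 3 * z * D w * D σ +
        z * w * D (D σ)) + D w * (w * σ + 2 * z * D w * σ + z * w * D σ)) +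
      (w ^ 2 + 2 * z * w * D w) * (w * (w * σ + 2 * z * D w * σ + z * w * D σ)) := by
    simp only [hD, pow_two, map_add, hz, hD2]; ring
  rw [e, hw2]
  apply (mul_eq_zero.mp _).resolve_left hk0
  linear_combination z ^ 2 * w ^ 2 * hσ -
    k * (8 * z * w ^ 3 * D w * σ + 3 * z * w ^ 4 * D σ + (c * z + 1) * w ^ 4 * σ) * hcz

end DifferentialFields

/-! ### The exponents at `z = 0` -/

section LocalAnalysis

local notation "ι" => HahnSeries.ofPowerSeries ℤ ℚ
local notation "φ" => algebraMap Qz (LaurentSeries ℚ)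
local notation "zL" => (HahnSeries.single (1 : ℤ) (1 : ℚ) : LaurentSeries ℚ)

theorem algebraMap_ratFunc_X : φ RatFunc.X = zL := by
  rw [← RatFunc.algebraMap_X, laurent_algebraMap_polynomial, Polynomial.coe_X,
    HahnSeries.ofPowerSeries_X]

theorem derLaurent_single_one : derLaurent zL = 1 := by
  rw [← algebraMap_ratFunc_X, derLaurent_algebraMap, dz_ratFunc_X, map_one]

theorem single_neg_one_mul_single_one : (HahnSeries.single (-1) 1 : LaurentSeries ℚ) * zL = 1 := by
  rw [HahnSeries.single_mul_single]
  simp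

theorem algebraMap_inv_X : φ (RatFunc.X : Qz)⁻¹ = HahnSeries.single (-1) 1 := by
  rw [map_inv₀, algebraMap_ratFunc_X]
  exact (eq_inv_of_mul_eq_one_left single_neg_one_mul_single_one).symm

/-- The data of a self-dual cubic operator at a point of maximally unipotent monodromy: the
coefficients, written with the Euler operator, are power series whose constant terms are
determined by the single exponent `r`. -/
theorem exists_powerSeries_of_mum {l s t : Qz} (hl : l ≠ 0)
    (hM : IsRegularAtZero (C l * selfDualCubic dz s t) ∧
      ∃ r : ℤ, indicial (C l * selfDualCubic dz s t) =
        (X - C (r : ℚ)) ^ (C l * selfDualCubic dz s t).natDegree) :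
    ∃ (r : ℤ) (A₀ A₁ A₂ : PowerSeries ℚ),
      ι A₀ = zL ^ 3 *
        φ (t * s + dz t / 2 - dz (dz s) / 2 - 3 * s * dz s - 2 * s ^ 3) ∧
      ι A₁ = zL ^ 2 * φ t ∧ ι A₂ = zL * φ (3 * s) ∧
      PowerSeries.constantCoeff A₀ = -r ^ 3 ∧
      PowerSeries.constantCoeff A₁ = 3 * r ^ 2 - 3 * r + 1 ∧
      PowerSeries.constantCoeff A₂ = 3 - 3 * r := by
  have hdeg : (C l * selfDualCubic dz s t).natDegree = 3 := by
    rw [natDegree_C_mul hl]; exact natDegree_cubic _ _ _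
  obtain ⟨hreg, r, hr⟩ := hM
  have hco := coeff_C_mul_cubic l (3 * s) t
    (t * s + dz t / 2 - dz (dz s) / 2 - 3 * s * dz s - 2 * s ^ 3)
  rw [← selfDualCubic] at hco
  have hlead : (C l * selfDualCubic dz s t).leadingCoeff = l := by
    rw [leadingCoeff, hdeg, hco.2.2.2]
  have hn : ∀ i, normCoeff (C l * selfDualCubic dz s t) i =
      φ (RatFunc.X ^ (3 - i) * (C l * selfDualCubic dz s t).coeff i / l) := by
    intro i; rw [normCoeff, hdeg, hlead]
  have n0 := hn 0
  have n1 := hn 1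
  have n2 := hn 2
  have n3 := hn 3
  rw [hco.1, mul_left_comm, mul_div_cancel_left₀ _ hl, map_mul, map_pow,
    algebraMap_ratFunc_X] at n0
  rw [hco.2.1, mul_left_comm, mul_div_cancel_left₀ _ hl, map_mul, map_pow,
    algebraMap_ratFunc_X] at n1
  rw [hco.2.2.1, mul_left_comm, mul_div_cancel_left₀ _ hl, map_mul, map_pow,
    algebraMap_ratFunc_X] at n2
  rw [hco.2.2.2, Nat.sub_self, pow_zero, one_mul, div_self hl, map_one] at n3
  obtain ⟨A₀, hA₀⟩ := exists_ofPowerSeries_eq (hreg 0 (by omega))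
  obtain ⟨A₁, hA₁⟩ := exists_ofPowerSeries_eq (hreg 1 (by omega))
  obtain ⟨A₂, hA₂⟩ := exists_ofPowerSeries_eq (hreg 2 (by omega))
  refine ⟨r, A₀, A₁, A₂, hA₀.trans n0, hA₁.trans n1, ?_, ?_⟩
  · rw [hA₂, n2]; norm_num
  rw [indicial, hdeg] at hr
  simp only [Finset.sum_range_succ, Finset.sum_range_zero, ← hA₀, ← hA₁, ← hA₂, n3,
    coeff_zero_ofPowerSeries, HahnSeries.coeff_one] at hr
  -- three values determine the constant terms
  have e0 := congrArg (eval 0) hr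
  have e1 := congrArg (eval 1) hr
  have e2 := congrArg (eval 2) hr
  simp [descPochhammer_succ_right] at e0 e1 e2
  norm_num at e0 e1 e2
  refine ⟨?_, ?_, ?_⟩
  · linear_combination e0
  · linear_combination e1 - e0
  · linear_combination (e2 - 2 * e1 + e0) / 2

/-- `X ^ n * u` under the Euler operator. -/
theorem X_mul_derivative_X_pow_mul (n : ℕ) (u : PowerSeries ℚ) :
    PowerSeries.X * PowerSeries.derivative ℚ (PowerSeries.X ^ n * u) =
      PowerSeries.X ^ n * ((n : PowerSeries ℚ) * u + PowerSeries.X * PowerSeries.derivative ℚ u) := by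
  rw [Derivation.leibniz, PowerSeries.derivative_pow, PowerSeries.derivative_X]
  simp only [smul_eq_mul]
  rcases n with _ | n
  · simp
  · rw [Nat.add_sub_cancel]; push_cast; ring

/-- The exponent of a power series solution is the root `r` of the indicial polynomial. -/
theorem exponent_eq {r : ℤ} {A₀ A₁ A₂ u : PowerSeries ℚ} {a s3 t : LaurentSeries ℚ} {n : ℕ}
    (hA₀ : ι A₀ = zL ^ 3 * a) (hA₁ : ι A₁ = zL ^ 2 * t) (hA₂ : ι A₂ = zL * s3)
    (h₀ : PowerSeries.constantCoeff A₀ = -r ^ 3)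
    (h₁ : PowerSeries.constantCoeff A₁ = 3 * r ^ 2 - 3 * r + 1)
    (h₂ : PowerSeries.constantCoeff A₂ = 3 - 3 * r)
    (hu : PowerSeries.constantCoeff u = 1)
    (hy : derLaurent (derLaurent (derLaurent (ι (PowerSeries.X ^ n * u)))) +
      s3 * derLaurent (derLaurent (ι (PowerSeries.X ^ n * u))) +
      t * derLaurent (ι (PowerSeries.X ^ n * u)) + a * ι (PowerSeries.X ^ n * u) = 0) :
    (n : ℤ) = r := by
  set Y := PowerSeries.X ^ n * u with hY
  set T : PowerSeries ℚ → PowerSeries ℚ :=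
    fun v => (n : PowerSeries ℚ) * v + PowerSeries.X * PowerSeries.derivative ℚ v with hT
  have hXT : ∀ v, PowerSeries.X * PowerSeries.derivative ℚ (PowerSeries.X ^ n * v) =
      PowerSeries.X ^ n * T v := fun v => X_mul_derivative_X_pow_mul n v
  have hT0 : ∀ v, PowerSeries.constantCoeff (T v) = n * PowerSeries.constantCoeff v := by
    intro v; simp [hT]
  simp only [derLaurent_ofPowerSeries] at hy
  set d := PowerSeries.derivative ℚ with hd
  have e1 : PowerSeries.X * d Y = PowerSeries.X ^ n * T u := hXT u
  have e2 : PowerSeries.X ^ 2 * d (d Y) = PowerSeries.X ^ n * (T (T u) - T u) := by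
    have := congrArg (fun v => PowerSeries.X * d v) e1
    simp only [hXT] at this
    rw [hd, Derivation.leibniz, PowerSeries.derivative_X, ← hd] at this
    simp only [smul_eq_mul] at this
    linear_combination this - e1
  have e3 : PowerSeries.X ^ 3 * d (d (d Y)) =
      PowerSeries.X ^ n * (T (T (T u) - T u) - 2 * (T (T u) - T u)) := by
    have := congrArg (fun v => PowerSeries.X * d v) e2
    simp only [hXT] at this
    rw [hd, Derivation.leibniz, PowerSeries.derivative_pow, PowerSeries.derivative_X, ← hd] at this
    simp only [smul_eq_mul] at this
    push_cast at this
    linear_combination this - 2 * e2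
  have hP : PowerSeries.X ^ 3 * d (d (d Y)) + A₂ * (PowerSeries.X ^ 2 * d (d Y)) +
      A₁ * (PowerSeries.X * d Y) + A₀ * Y = 0 := by
    apply HahnSeries.ofPowerSeries_injective (Γ := ℤ)
    simp only [map_add, map_mul, map_pow, HahnSeries.ofPowerSeries_X, hA₀, hA₁, hA₂, map_zero]
    linear_combination zL ^ 3 * hy
  rw [e1, e2, e3, hY] at hP
  have hP' : PowerSeries.X ^ n * ((T (T (T u) - T u) - 2 * (T (T u) - T u)) +
      A₂ * (T (T u) - T u) + A₁ * T u + A₀ * u) = 0 := by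
    linear_combination hP
  have hQ := (mul_eq_zero.mp hP').resolve_left (pow_ne_zero _ PowerSeries.X_ne_zero)
  have hc := congrArg PowerSeries.constantCoeff hQ
  simp only [map_add, map_sub, map_mul, hT0, hu, h₀, h₁, h₂, map_zero, map_ofNat] at hc
  have h3 : ((n : ℚ) - r) ^ 3 = 0 := by linear_combination hc
  have h4 : (n : ℚ) = r := by
    linarith [pow_eq_zero_iff (three_ne_zero) |>.mp h3]
  exact_mod_cast h4

theorem exists_eq_C_mul_X_pow_mul {p : ℚ[X]} (hp : p ≠ 0) :
    ∃ (b : ℚ) (i : ℕ) (q : ℚ[X]), b ≠ 0 ∧ q.coeff 0 = 1 ∧ p = C b * X ^ i * q := by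
  obtain ⟨q, hq, hq0⟩ := Polynomial.exists_eq_pow_rootMultiplicity_mul_and_not_dvd p hp 0
  rw [map_zero, sub_zero] at hq hq0
  rw [X_dvd_iff] at hq0
  refine ⟨q.coeff 0, p.rootMultiplicity 0, C (q.coeff 0)⁻¹ * q, hq0, ?_, ?_⟩
  · simp [hq0]
  · nth_rewrite 1 [hq]
    have : C (q.coeff 0) * C (q.coeff 0)⁻¹ = 1 := by
      rw [← C_mul, mul_inv_cancel₀ hq0, C_1]
    linear_combination (-(X ^ p.rootMultiplicity 0 * q)) * this

/-- The expansion at `z = 0` of a rational function is, up to a monomial, an N-integral series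
with constant term `1`. -/
theorem exists_nIntegral_of_ratFunc {β : Qz} (hβ : β ≠ 0) :
    ∃ (b : ℚ) (i j : ℕ) (U : PowerSeries ℚ), b ≠ 0 ∧ PowerSeries.constantCoeff U = 1 ∧
      NIntegral U ∧
        φ β * ι (PowerSeries.X ^ j) = ι (PowerSeries.C b * (PowerSeries.X ^ i * U)) := by
  obtain ⟨b, i, p, hb, hp, hnum⟩ := exists_eq_C_mul_X_pow_mul (RatFunc.num_ne_zero hβ)
  obtain ⟨e, j, q, he, hq, hden⟩ := exists_eq_C_mul_X_pow_mul (RatFunc.denom_ne_zero β)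
  have hq1 : PowerSeries.constantCoeff (q : PowerSeries ℚ) = 1 := by
    rw [← PowerSeries.coeff_zero_eq_constantCoeff_apply, Polynomial.coeff_coe, hq]
  have hp1 : PowerSeries.constantCoeff (p : PowerSeries ℚ) = 1 := by
    rw [← PowerSeries.coeff_zero_eq_constantCoeff_apply, Polynomial.coeff_coe, hp]
  have hinv : (q : PowerSeries ℚ) * (q : PowerSeries ℚ)⁻¹ = 1 :=
    PowerSeries.mul_inv_cancel _ (by rw [hq1]; exact one_ne_zero)
  refine ⟨b / e, i, j, p * (q : PowerSeries ℚ)⁻¹, div_ne_zero hb he, ?_,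
    (nIntegral_coe_polynomial hp).mul ((nIntegral_coe_polynomial hq).of_mul_eq_one hq1 hinv), ?_⟩
  · rw [map_mul, PowerSeries.constantCoeff_inv, hp1, hq1]; norm_num
  have hq0 : algebraMap ℚ[X] Qz β.denom ≠ 0 := by simpa using β.denom_ne_zero
  have ha : β * algebraMap ℚ[X] Qz β.denom = algebraMap ℚ[X] Qz β.num := by
    nth_rewrite 1 [← RatFunc.num_div_denom β]
    rw [div_mul_cancel₀ _ hq0]
  have hF := congrArg φ ha
  rw [map_mul, laurent_algebraMap_polynomial, laurent_algebraMap_polynomial, hnum, hden] at hF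
  simp only [Polynomial.coe_mul, Polynomial.coe_C, Polynomial.coe_pow, Polynomial.coe_X] at hF
  have hinv' := congrArg ι hinv
  have hbe : PowerSeries.C b = PowerSeries.C (b / e) * PowerSeries.C e := by
    rw [← map_mul, div_mul_cancel₀ _ he]
  have hCe : ι (PowerSeries.C e) ≠ 0 := by
    rw [HahnSeries.ofPowerSeries_C]; exact HahnSeries.C_ne_zero he
  apply mul_left_cancel₀ hCe
  rw [hbe] at hF
  simp only [map_mul, map_one] at hF hinv' ⊢
  linear_combination ι (q : PowerSeries ℚ)⁻¹ * hF - φ β * ι (PowerSeries.C e) *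
    ι (PowerSeries.X ^ j) * hinv'

/-! ### The square root of a solution -/

/-- The coefficient `d` for which the symmetric square of `∂² + z⁻¹ ∂ + d` is a twist of the
self-dual cubic operator with coefficients `3s` and `t`. -/
def quadraticCoeff (s t : Qz) : Qz :=
  (t - 3 * dz s - 3 * s ^ 2) / 4 - (RatFunc.X : Qz)⁻¹ ^ 2 / 4

theorem algebraMap_eq_quadraticCoeff (s t : Qz) :
    φ t = 4 * φ (quadraticCoeff s t) + φ (RatFunc.X : Qz)⁻¹ ^ 2 + 3 * derLaurent (φ s) +
      3 * φ s ^ 2 := by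
  have h : t = 4 * quadraticCoeff s t + (RatFunc.X : Qz)⁻¹ ^ 2 + 3 * dz s + 3 * s ^ 2 := by
    rw [quadraticCoeff]; ring
  nth_rewrite 1 [h]
  simp only [map_add, map_mul, map_pow, map_ofNat, derLaurent_algebraMap]

/-- The exponents of `∂² + z⁻¹ ∂ + d` at `z = 0` are both zero. -/
theorem exists_ofPowerSeries_quadraticCoeff {r : ℤ} {A₁ A₂ : PowerSeries ℚ} {s t : Qz}
    (hA₁ : ι A₁ = zL ^ 2 * φ t) (hA₂ : ι A₂ = zL * φ (3 * s))
    (h₁ : PowerSeries.constantCoeff A₁ = 3 * r ^ 2 - 3 * r + 1)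
    (h₂ : PowerSeries.constantCoeff A₂ = 3 - 3 * r) :
    ∃ B : PowerSeries ℚ, PowerSeries.constantCoeff B = 0 ∧
      ι B = zL ^ 2 * φ (quadraticCoeff s t) := by
  have hz := derLaurent_single_one
  have hcz : φ (RatFunc.X : Qz)⁻¹ * zL = 1 := by
    rw [algebraMap_inv_X, single_neg_one_mul_single_one]
  have h3 : φ (3 * s) = 3 * φ s := by rw [map_mul, map_ofNat]
  have hd3 : derLaurent 3 = 0 := leibniz_natCast derLaurent_mul 3
  have ht := algebraMap_eq_quadraticCoeff s t
  refine ⟨PowerSeries.C (1 / 12) * (3 * A₁ - 3 * (PowerSeries.X * PowerSeries.derivative ℚ A₂) +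
    3 * A₂ - A₂ ^ 2 - 3), ?_, ?_⟩
  · simp only [map_mul, map_add, map_sub, map_pow, map_ofNat, h₁, h₂,
      PowerSeries.constantCoeff_X, zero_mul]
    ring
  have hC : (12 : LaurentSeries ℚ) * ι (PowerSeries.C (1 / 12)) = 1 := by
    rw [← map_ofNat ι 12, ← map_ofNat (PowerSeries.C (R := ℚ)) 12, ← map_mul, ← map_mul]
    norm_num
  have hX : ι (PowerSeries.X * PowerSeries.derivative ℚ A₂) =
      zL * (3 * φ s + zL * (3 * derLaurent (φ s))) := by
    rw [map_mul, HahnSeries.ofPowerSeries_X, ← derLaurent_ofPowerSeries, hA₂, h3, derLaurent_mul,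
      derLaurent_mul, hz, hd3]
    ring
  have h12 : (12 : LaurentSeries ℚ) ≠ 0 := left_ne_zero_of_mul_eq_one hC
  apply mul_left_cancel₀ h12
  rw [map_mul, ← mul_assoc, hC]
  simp only [map_add, map_sub, map_mul ι 3, map_pow, map_ofNat, hX, hA₁, hA₂, h3, ht]
  linear_combination 3 * (φ (RatFunc.X : Qz)⁻¹ * zL + 1) * hcz

/-- A power series solution `y` of the self-dual cubic operator is `k w²`, where `w` solves the
operator of order two. The series `w` is obtained from `w⁴ U = u²`, where `U` and `u` are the
parts of `β` and `y` that have constant term one; the constant `z² w³ (w'' + z⁻¹ w' + d w)` vanishes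
because it has no constant term. -/
theorem exists_sqrt_solution {r : ℤ} {A₀ A₁ A₂ : PowerSeries ℚ} {s t β : Qz}
    (hA₀ : ι A₀ = zL ^ 3 * φ (t * s + dz t / 2 - dz (dz s) / 2 - 3 * s * dz s - 2 * s ^ 3))
    (hA₁ : ι A₁ = zL ^ 2 * φ t) (hA₂ : ι A₂ = zL * φ (3 * s))
    (h₀ : PowerSeries.constantCoeff A₀ = -r ^ 3)
    (h₁ : PowerSeries.constantCoeff A₁ = 3 * r ^ 2 - 3 * r + 1)
    (h₂ : PowerSeries.constantCoeff A₂ = 3 - 3 * r)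
    (hβ0 : β ≠ 0) (hβ : dz β = -2 * s * β) {n : ℕ} {u : PowerSeries ℚ}
    (hu : PowerSeries.constantCoeff u = 1)
    (hy : derLaurent (derLaurent (derLaurent (ι (PowerSeries.X ^ n * u)))) +
      φ (3 * s) * derLaurent (derLaurent (ι (PowerSeries.X ^ n * u))) +
      φ t * derLaurent (ι (PowerSeries.X ^ n * u)) +
      φ (t * s + dz t / 2 - dz (dz s) / 2 - 3 * s * dz s - 2 * s ^ 3) *
        ι (PowerSeries.X ^ n * u) = 0) :
    ∃ (w : PowerSeries ℚ) (k : LaurentSeries ℚ), PowerSeries.constantCoeff w = 1 ∧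
      (NIntegral u → NIntegral w) ∧ k ≠ 0 ∧
      derLaurent k = (φ (RatFunc.X : Qz)⁻¹ - φ s) * k ∧
      ι (PowerSeries.X ^ n * u) = k * ι w ^ 2 ∧
      derLaurent (derLaurent (ι w)) + φ (RatFunc.X : Qz)⁻¹ * derLaurent (ι w) +
        φ (quadraticCoeff s t) * ι w = 0 := by
  have hn : (n : ℤ) = r := exponent_eq hA₀ hA₁ hA₂ h₀ h₁ h₂ hu hy
  have hnQ : (n : ℚ) = r := by exact_mod_cast hn
  have hz := derLaurent_single_one
  have hcz : φ (RatFunc.X : Qz)⁻¹ * zL = 1 := by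
    rw [algebraMap_inv_X, single_neg_one_mul_single_one]
  have hz0 : zL ≠ 0 := single_one_ne_zero
  have h3 : φ (3 * s) = 3 * φ s := by rw [map_mul, map_ofNat]
  obtain ⟨b, i, j, U, hb, hU1, hUN, hU⟩ := exists_nIntegral_of_ratFunc hβ0
  have hβ' : derLaurent (φ β) = -2 * φ s * φ β := by
    rw [derLaurent_algebraMap, hβ]; simp only [map_mul, map_neg, map_ofNat]
  -- the order `i - j` of `β` is the residue `2n - 2` of its logarithmic derivative
  have hij : i + 2 = j + 2 * n := by
    have e := congrArg (fun x => zL * derLaurent x) hU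
    simp only [derLaurent_mul, hβ', derLaurent_ofPowerSeries] at e
    have e' : ι (PowerSeries.C b * (PowerSeries.X ^ i * U)) *
        (ι (PowerSeries.C (j : ℚ)) - ι (PowerSeries.C (2 / 3 : ℚ)) * ι A₂) =
        ι (PowerSeries.C b * (PowerSeries.X ^ i * ((i : PowerSeries ℚ) * U +
          PowerSeries.X * PowerSeries.derivative ℚ U))) := by
      have ej : zL * ι (PowerSeries.derivative ℚ (PowerSeries.X ^ j)) =
          ι (PowerSeries.C (j : ℚ)) * ι (PowerSeries.X ^ j) := by
        have := X_mul_derivative_X_pow_mul j 1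
        rw [mul_one, Derivation.map_one_eq_zero, mul_zero, add_zero, mul_one] at this
        rw [← HahnSeries.ofPowerSeries_X, ← map_mul, this, map_natCast, map_mul]
        ring
      have ei : zL * ι (PowerSeries.derivative ℚ (PowerSeries.C b * (PowerSeries.X ^ i * U))) =
          ι (PowerSeries.C b * (PowerSeries.X ^ i * ((i : PowerSeries ℚ) * U +
            PowerSeries.X * PowerSeries.derivative ℚ U))) := by
        rw [← HahnSeries.ofPowerSeries_X, ← map_mul, ← X_mul_derivative_X_pow_mul,
          Derivation.leibniz, PowerSeries.derivative_C]
        simp only [smul_eq_mul]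
        congr 1
        ring
      have eA : ι (PowerSeries.C (2 / 3 : ℚ)) * ι A₂ = 2 * (zL * φ s) := by
        have : ι (PowerSeries.C (2 / 3 : ℚ)) * 3 = 2 := by
          rw [← map_ofNat ι 3, ← map_ofNat (PowerSeries.C (R := ℚ)) 3, ← map_mul, ← map_mul,
            ← map_ofNat ι 2, ← map_ofNat (PowerSeries.C (R := ℚ)) 2]
          norm_num
        rw [hA₂, h3]
        linear_combination (zL * φ s) * this
      rw [← ei, ← e, eA, ← hU]
      linear_combination (-φ β) * ej
    rw [← map_mul, ← map_sub, ← map_mul] at e'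
    have e2 := HahnSeries.ofPowerSeries_injective e'
    rw [mul_assoc, mul_assoc] at e2
    have hCb : PowerSeries.C b ≠ 0 := by
      simpa using hb
    have e3 := mul_left_cancel₀ (pow_ne_zero i PowerSeries.X_ne_zero) (mul_left_cancel₀ hCb e2)
    have e4 := congrArg PowerSeries.constantCoeff e3
    simp [hU1, h₂] at e4
    have : (i : ℚ) + 2 = j + 2 * n := by rw [hnQ]; linear_combination -e4
    exact_mod_cast this
  have hUinv : U * U⁻¹ = 1 := PowerSeries.mul_inv_cancel _ (by rw [hU1]; exact one_ne_zero)
  obtain ⟨v, hv1, hv⟩ := exists_sq_eq (f := U⁻¹ * u ^ 2)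
    (by simp [hU1, hu])
  obtain ⟨w, hw1, hw⟩ := exists_sq_eq hv1
  have hw0 : ι w ≠ 0 := by
    rw [map_ne_zero_iff _ HahnSeries.ofPowerSeries_injective]
    rintro rfl
    simp at hw1
  have hu0 : u ≠ 0 := by rintro rfl; simp at hu
  have hy0 : ι (PowerSeries.X ^ n * u) ≠ 0 := by
    rw [map_ne_zero_iff _ HahnSeries.ofPowerSeries_injective]
    exact mul_ne_zero (pow_ne_zero _ PowerSeries.X_ne_zero) hu0
  obtain ⟨k, hk⟩ : ∃ k, ι (PowerSeries.X ^ n * u) = k * ι w ^ 2 :=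
    ⟨ι (PowerSeries.X ^ n * u) / ι w ^ 2, by field_simp⟩
  have hk0 : k ≠ 0 := by rintro rfl; rw [zero_mul] at hk; exact hy0 hk
  have hbk : ι (PowerSeries.C b) * k ^ 2 = zL ^ 2 * φ β := by
    have e1 : w ^ 4 * U = u ^ 2 := by
      rw [show w ^ 4 = (w ^ 2) ^ 2 by ring, hw, hv]
      linear_combination u ^ 2 * hUinv
    have e2 := congrArg ι e1
    have hne : ι w ^ 4 * (zL ^ i * ι U) ≠ 0 := by
      refine mul_ne_zero (pow_ne_zero _ hw0) (mul_ne_zero (pow_ne_zero _ hz0) ?_)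
      rw [map_ne_zero_iff _ HahnSeries.ofPowerSeries_injective]
      rintro rfl; simp at hU1
    apply mul_right_cancel₀ hne
    simp only [map_mul, map_pow, HahnSeries.ofPowerSeries_X] at hU hk e2
    have e3 : zL ^ i * zL ^ 2 = zL ^ j * (zL ^ n) ^ 2 := by
      rw [← pow_add, hij, ← pow_mul, ← pow_add, mul_comm n]
    -- both sides are equal to `b z ^ (2 n + i) u ^ 2 U`
    have e4 : (k * ι w ^ 2) ^ 2 = (zL ^ n * ι u) ^ 2 := by rw [hk]
    linear_combination ι (PowerSeries.C b) * zL ^ i * ι U * e4 - φ β * ι w ^ 4 * ι U * e3 -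
      (zL ^ n) ^ 2 * ι w ^ 4 * ι U * hU - ι (PowerSeries.C b) * zL ^ i * (zL ^ n) ^ 2 * ι U * e2
  have hCb : ι (PowerSeries.C b) ≠ 0 := by
    rw [HahnSeries.ofPowerSeries_C]; exact HahnSeries.C_ne_zero hb
  have hk' : derLaurent k = (φ (RatFunc.X : Qz)⁻¹ - φ s) * k := by
    have e := congrArg derLaurent hbk
    simp only [derLaurent_mul, derLaurent_ofPowerSeries, PowerSeries.derivative_C, map_zero,
      pow_two, hz, hβ'] at e
    apply mul_left_cancel₀ (mul_ne_zero (mul_ne_zero two_ne_zero hCb) hk0)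
    linear_combination e - 2 * (φ (RatFunc.X : Qz)⁻¹ - φ s) * hbk - 2 * zL * φ β * hcz
  refine ⟨w, k, hw1, fun huN => ?_, hk0, hk', hk, ?_⟩
  · have hvN : NIntegral (v ^ 2) := by
      rw [hv, pow_two]
      exact (hUN.of_mul_eq_one hU1 hUinv).mul (huN.mul huN)
    have := hvN.of_sq hv1
    rw [← hw] at this
    exact this.of_sq hw1
  · obtain ⟨B, hB0, hB⟩ := exists_ofPowerSeries_quadraticCoeff hA₁ hA₂ h₁ h₂
    set E := derLaurent (derLaurent (ι w)) + φ (RatFunc.X : Qz)⁻¹ * derLaurent (ι w) +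
      φ (quadraticCoeff s t) * ι w with hE
    have hconst : derLaurent (zL ^ 2 * ι w ^ 3 * E) = 0 := by
      refine derivation_sq_mul_cube_mul_eq_zero derLaurent_mul hz hcz hk0 hk'
        (algebraMap_eq_quadraticCoeff s t) hE.symm ?_
      rw [← hk, ← hy]
      simp only [map_add, map_sub, map_mul, map_pow, map_div₀, map_ofNat, derLaurent_algebraMap]
    have hps : zL ^ 2 * ι w ^ 3 * E =
        ι (w ^ 3 * (PowerSeries.X ^ 2 * PowerSeries.derivative ℚ (PowerSeries.derivative ℚ w) +
          PowerSeries.X * PowerSeries.derivative ℚ w + B * w)) := by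
      simp only [map_add, map_mul, map_pow, hB, HahnSeries.ofPowerSeries_X,
        ← derLaurent_ofPowerSeries, hE]
      linear_combination zL * ι w ^ 3 * derLaurent (ι w) * hcz
    have hzero := eq_C_of_derLaurent_eq_zero hconst
    rw [hps, coeff_zero_ofPowerSeries, ← hps] at hzero
    simp [hB0, hw0] at hzero
    exact hzero

/-! ### Logarithmic solutions -/

theorem dlog_linear (a b : LaurentSeries ℚ) : dlog (C a + C b * X) =
    C (derLaurent a + φ (RatFunc.X : Qz)⁻¹ * b) + C (derLaurent b) * X := by
  rw [dlog, algebraMap_inv_X, ← coe_derLaurent]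
  ext1 n
  rw [coeff_add, coeff_mapCoeffs _ (map_zero _), coeff_C_mul, coeff_derivative]
  rcases n with _ | _ | n <;> simp [coeff_C, coeff_X]

theorem smul_linear (q : Qz) (a b : LaurentSeries ℚ) :
    q • (C a + C b * X : LogSeries) = C (φ q * a) + C (φ q * b) * X := by
  ext1 m
  rw [coeff_smul, Algebra.smul_def]
  simp only [coeff_add, coeff_C_mul, coeff_C]
  split_ifs <;> ring

theorem linear_eq_zero_iff (a b : LaurentSeries ℚ) :
    (C a + C b * X : LogSeries) = 0 ↔ a = 0 ∧ b = 0 := by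
  constructor
  · intro h
    have h0 := congrArg (fun p => coeff p 0) h
    have h1 := congrArg (fun p => coeff p 1) h
    simpa [coeff_C] using And.intro h0 h1
  · rintro ⟨rfl, rfl⟩
    simp

theorem linear_add (a b a' b' : LaurentSeries ℚ) :
    (C a + C b * X : LogSeries) + (C a' + C b' * X) = C (a + a') + C (b + b') * X := by
  simp only [map_add]; ring

theorem flagFun_zero (f : ℕ → PowerSeries ℚ) :
    flagFun f 0 = C (ι (f 0)) + C 0 * X := by
  simp [flagFun]

theorem flagFun_one (f : ℕ → PowerSeries ℚ) :
    flagFun f 1 = C (ι (f 1)) + C (ι (f 0)) * X := by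
  simp [flagFun, Finset.sum_range_succ]

/-- The first structure series depends only on the quotient `f₁ / f₀`. -/
theorem structureSeries_one {f : ℕ → PowerSeries ℚ} {h : LaurentSeries ℚ}
    (h0 : f 0 ≠ 0) (h1 : ι (f 1) = ι (f 0) * h) :
    structureSeries f 1 = (zL * (φ (RatFunc.X : Qz)⁻¹ + derLaurent h))⁻¹ := by
  have hf0 : ι (f 0) ≠ 0 := by rwa [map_ne_zero_iff _ HahnSeries.ofPowerSeries_injective]
  have hlin : C ((flagFun f 0).coeff 0)⁻¹ * flagFun f 1 = C h + C 1 * X := by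
    rw [flagFun_zero, flagFun_one, h1]
    simp only [coeff_add, coeff_C_zero, coeff_C_mul, coeff_X_zero, mul_zero, add_zero]
    rw [mul_add, ← mul_assoc, ← C_mul, ← C_mul, inv_mul_cancel_left₀ hf0, inv_mul_cancel₀ hf0]
  rw [structureSeries, normalSeq, normalSeq, normalSeq, hlin, theta, dlog_linear]
  simp [add_comm]

theorem coeff_inv_X_mul (x : LaurentSeries ℚ) (n : ℤ) :
    (φ (RatFunc.X : Qz)⁻¹ * x).coeff (n - 1) = x.coeff n := by
  rw [algebraMap_inv_X, sub_eq_add_neg, HahnSeries.coeff_single_mul_add, one_mul]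

/-- The first two solutions `y₀`, `y₀ τ` of a flag of the cubic operator give a flag `w`, `w τ` of
the operator of order two: `z w² τ'` is constant because the residue of its derivative vanishes,
and the constant is `1` because `τ' - z⁻¹` has no residue. -/
theorem exists_flag_monicQuadratic {r : ℤ} {A₀ A₁ A₂ : PowerSeries ℚ} {l s t β : Qz}
    (hA₀ : ι A₀ = zL ^ 3 * φ (t * s + dz t / 2 - dz (dz s) / 2 - 3 * s * dz s - 2 * s ^ 3))
    (hA₁ : ι A₁ = zL ^ 2 * φ t) (hA₂ : ι A₂ = zL * φ (3 * s))
    (h₀ : PowerSeries.constantCoeff A₀ = -r ^ 3)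
    (h₁ : PowerSeries.constantCoeff A₁ = 3 * r ^ 2 - 3 * r + 1)
    (h₂ : PowerSeries.constantCoeff A₂ = 3 - 3 * r)
    (hβ0 : β ≠ 0) (hβ : dz β = -2 * s * β) (hl : l ≠ 0) {f : ℕ → PowerSeries ℚ}
    (hf : IsFlag (C l * selfDualCubic dz s t) f) :
    ∃ g : ℕ → PowerSeries ℚ,
      IsFlag (monicQuadratic (RatFunc.X : Qz)⁻¹ (quadraticCoeff s t)) g ∧
        structureSeries g 1 = structureSeries f 1 := by
  have hdeg : (C l * selfDualCubic dz s t).natDegree = 3 := by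
    rw [natDegree_C_mul hl]; exact natDegree_cubic _ _ _
  obtain ⟨⟨n, u, hu, hfu⟩, hsol⟩ := hf
  rw [hdeg] at hsol
  have s0 := hsol 0 (by omega)
  have s1 := hsol 1 (by omega)
  rw [act_C_mul_selfDualCubic, smul_eq_zero_iff_right hl, flagFun_zero] at s0
  rw [act_C_mul_selfDualCubic, smul_eq_zero_iff_right hl, flagFun_one] at s1
  simp only [dlog_linear, smul_linear, linear_add, linear_eq_zero_iff] at s0 s1
  have s0' := s0.1
  simp only [map_zero, mul_zero, add_zero] at s0'
  obtain ⟨w, k, hw1, -, hk0, hk', hk, hw⟩ := exists_sqrt_solution hA₀ hA₁ hA₂ h₀ h₁ h₂ hβ0 hβ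
    (n := n) hu (by rw [← hfu]; linear_combination s0')
  rw [← hfu] at hk
  have hw0 : ι w ≠ 0 := by
    rw [map_ne_zero_iff _ HahnSeries.ofPowerSeries_injective]
    rintro rfl
    simp at hw1
  have hf0 : ι (f 0) ≠ 0 := by rw [hk]; exact mul_ne_zero hk0 (pow_ne_zero _ hw0)
  have hz := derLaurent_single_one
  have hcz : φ (RatFunc.X : Qz)⁻¹ * zL = 1 := by
    rw [algebraMap_inv_X, single_neg_one_mul_single_one]
  obtain ⟨h, hh⟩ : ∃ h, ι (f 1) = ι (f 0) * h := ⟨ι (f 1) / ι (f 0), by field_simp⟩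
  set c := φ (RatFunc.X : Qz)⁻¹ with hc
  set σ := c + derLaurent h with hσ
  have hdh : derLaurent h = σ - c := by rw [hσ]; ring
  -- the equation of `y₀ (ln z + h)` minus `ln z + h` times the equation of `y₀`
  have s1' := s1.1
  rw [hh] at s1'
  simp only [map_add derLaurent, derLaurent_mul, hdh, map_sub derLaurent] at s1'
  have hbr : 3 * derLaurent (derLaurent (ι (f 0))) * σ + 3 * derLaurent (ι (f 0)) * derLaurent σ +
      ι (f 0) * derLaurent (derLaurent σ) +
      3 * φ s * (2 * derLaurent (ι (f 0)) * σ + ι (f 0) * derLaurent σ) +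
      φ t * (ι (f 0) * σ) = 0 := by
    have h3 : φ (3 * s) = 3 * φ s := by rw [map_mul, map_ofNat]
    rw [h3] at s1' s0'
    linear_combination s1' - h * s0'
  rw [hk] at hbr
  have hκ0 := derivation_mul_derivation_eq_zero derLaurent_mul hz hcz hk0 hk'
    (algebraMap_eq_quadraticCoeff s t) hw hbr
  -- `V` is the inverse of `w²`
  obtain ⟨V, hV⟩ : ∃ V, w ^ 2 * V = 1 :=
    ⟨(w ^ 2)⁻¹, PowerSeries.mul_inv_cancel _ (by simp [hw1])⟩
  have hV1 : PowerSeries.constantCoeff V = 1 := by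
    have := congrArg PowerSeries.constantCoeff hV
    simpa [hw1] using this
  have hVL : ι w ^ 2 * ι V = 1 := by rw [← map_pow, ← map_mul, hV, map_one]
  have hVneg : ∀ m : ℤ, m < 0 → (ι V).coeff m = 0 := fun m hm => by
    rw [PowerSeries.coeff_coe, if_pos hm]
  have key : ∀ x b, zL * ι w ^ 2 * x = HahnSeries.C b → x = HahnSeries.C b * (c * ι V) := by
    intro x b hx
    rw [← hx]
    linear_combination -x * hVL - x * ι w ^ 2 * ι V * hcz
  have hcoV : ∀ b : ℚ, (HahnSeries.C b * (c * ι V)).coeff (-1) = b := by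
    intro b
    rw [HahnSeries.C_mul_eq_smul, HahnSeries.coeff_smul, show (-1 : ℤ) = 0 - 1 by norm_num,
      coeff_inv_X_mul, coeff_zero_ofPowerSeries, hV1, smul_eq_mul, mul_one]
  have hκ1 := key _ _ (eq_C_of_derLaurent_eq_zero hκ0)
  have hb0 := congrArg (fun x => x.coeff (-1)) hκ1
  simp only [hcoV, coeff_derLaurent] at hb0
  norm_num at hb0
  rw [← hb0, map_zero, zero_mul] at hκ1
  have hσV := key _ _ (eq_C_of_derLaurent_eq_zero hκ1)
  have hone := congrArg (fun x => x.coeff (-1)) hσV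
  simp only [hcoV] at hone
  have hσc : σ.coeff (-1) = 1 := by
    rw [hσ, HahnSeries.coeff_add, coeff_derLaurent, hc, algebraMap_inv_X]
    norm_num
  rw [hσc] at hone
  have hσ1 := eq_C_of_derLaurent_eq_zero hκ1
  have hC1 : (HahnSeries.C (1 : ℚ) : LaurentSeries ℚ) = 1 := map_one _
  rw [← hone, hC1] at hσ1 hσV
  rw [one_mul] at hσV
  obtain ⟨H, hH⟩ := exists_ofPowerSeries_eq (x := h) fun m hm => by
    have e : derLaurent h = c * (ι V - 1) := by rw [hdh, hσV]; ring
    have e2 := congrArg (fun x => x.coeff (m - 1)) e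
    simp only [coeff_derLaurent, hc, coeff_inv_X_mul, HahnSeries.coeff_sub, hVneg m hm,
      HahnSeries.coeff_one, hm.ne, sub_add_cancel] at e2
    push_cast at e2
    rw [sub_add_cancel] at e2
    simp [hm.ne] at e2
    exact e2
  let g : ℕ → PowerSeries ℚ := fun i => if i = 0 then w else w * H
  have hg0 : g 0 = w := rfl
  have hg1 : ι (g 1) = ι w * h := by rw [show g 1 = w * H from rfl, map_mul, hH]
  refine ⟨g, ⟨⟨0, w, hw1, by rw [hg0, pow_zero, one_mul]⟩, ?_⟩, ?_⟩
  · rw [natDegree_monicQuadratic]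
    intro i hi
    interval_cases i
    · rw [act_monicQuadratic, flagFun_zero, hg0]
      simp only [dlog_linear, smul_linear, linear_add, linear_eq_zero_iff]
      simp only [map_zero, mul_zero, add_zero, and_true]
      linear_combination hw
    · rw [act_monicQuadratic, flagFun_one, hg1, hg0]
      simp only [dlog_linear, smul_linear, linear_add, linear_eq_zero_iff]
      refine ⟨?_, by linear_combination hw⟩
      have hDσ := congrArg derLaurent hσ1
      have hD1 : derLaurent 1 = 0 := by simpa using leibniz_natCast derLaurent_mul 1
      simp only [derLaurent_mul, pow_two, hz, hD1] at hDσ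
      simp only [map_add derLaurent, derLaurent_mul, hdh, map_sub derLaurent, ← hc]
      apply mul_left_cancel₀ hw0
      linear_combination ι w * h * hw + c * hDσ -
        (2 * ι w * derLaurent (ι w) * σ + ι w ^ 2 * derLaurent σ) * hcz
  · rw [structureSeries_one (h := h) (by rw [hg0]; rintro rfl; simp at hw1) (by rw [hg1, hg0]),
      structureSeries_one (h := h) (by rintro h0; rw [h0] at hf0; simp at hf0) hh]

/-! ### The CY-type conditions -/

theorem exists_eq_C_mul_X_pow_mul_powerSeries {y : PowerSeries ℚ} (hy : y ≠ 0) :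
    ∃ (b : ℚ) (n : ℕ) (u : PowerSeries ℚ), b ≠ 0 ∧ PowerSeries.constantCoeff u = 1 ∧
      y = PowerSeries.C b * (PowerSeries.X ^ n * u) := by
  have hb := PowerSeries.coeff_order hy
  set n := y.order.toNat
  set b := PowerSeries.coeff n y
  obtain ⟨v, hv⟩ := (PowerSeries.X_pow_order_dvd : PowerSeries.X ^ y.order.toNat ∣ y)
  have hv0 : PowerSeries.constantCoeff v = b := by
    have := congrArg (PowerSeries.coeff (0 + n)) hv
    rw [PowerSeries.coeff_X_pow_mul, PowerSeries.coeff_zero_eq_constantCoeff_apply,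
      zero_add] at this
    exact this.symm
  refine ⟨b, n, PowerSeries.C b⁻¹ * v, hb, ?_, ?_⟩
  · rw [map_mul, hv0, PowerSeries.constantCoeff_C, inv_mul_cancel₀ hb]
  · have : PowerSeries.C b * PowerSeries.C b⁻¹ = 1 := by
      rw [← map_mul, mul_inv_cancel₀ hb, map_one]
    nth_rewrite 1 [hv]
    linear_combination (-(PowerSeries.X ^ n * v)) * this

theorem indicial_monicQuadratic {B : PowerSeries ℚ} {d : Qz}
    (hB0 : PowerSeries.constantCoeff B = 0) (hB : ι B = zL ^ 2 * φ d) :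
    IsRegularAtZero (monicQuadratic (RatFunc.X : Qz)⁻¹ d) ∧
      indicial (monicQuadratic (RatFunc.X : Qz)⁻¹ d) = X ^ 2 := by
  have hdeg := natDegree_monicQuadratic (RatFunc.X : Qz)⁻¹ d
  have hco := coeff_monicQuadratic (RatFunc.X : Qz)⁻¹ d
  have hlead : (monicQuadratic (RatFunc.X : Qz)⁻¹ d).leadingCoeff = 1 := by
    rw [leadingCoeff, hdeg, hco.2.2]
  have n0 : normCoeff (monicQuadratic (RatFunc.X : Qz)⁻¹ d) 0 = ι B := by
    rw [normCoeff, hdeg, hlead, hco.1, div_one, map_mul, map_pow, algebraMap_ratFunc_X, hB]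
  have n1 : normCoeff (monicQuadratic (RatFunc.X : Qz)⁻¹ d) 1 = ι 1 := by
    rw [normCoeff, hdeg, hlead, hco.2.1, div_one, pow_one,
      mul_inv_cancel₀ RatFunc.X_ne_zero, map_one, map_one]
  have n2 : normCoeff (monicQuadratic (RatFunc.X : Qz)⁻¹ d) 2 = ι 1 := by
    rw [normCoeff, hdeg, hlead, hco.2.2, Nat.sub_self, pow_zero, div_one, mul_one, map_one,
      map_one]
  constructor
  · intro i hi m hm
    rw [hdeg] at hi
    interval_cases i
    · rw [n0, PowerSeries.coeff_coe, if_pos hm]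
    · rw [n1, PowerSeries.coeff_coe, if_pos hm]
    · rw [n2, PowerSeries.coeff_coe, if_pos hm]
  · rw [indicial, hdeg]
    simp only [Finset.sum_range_succ, Finset.sum_range_zero, n0, n1, n2,
      coeff_zero_ofPowerSeries, hB0]
    simp [descPochhammer_succ_right]
    ring

/-- The CY-type properties pass from the self-dual cubic operator to the operator of order two. -/
theorem isCYType_monicQuadratic {l s t β : Qz} (hl : l ≠ 0) (hβ0 : β ≠ 0)
    (hβ : dz β = -2 * s * β) (hL : IsCYType (C l * selfDualCubic dz s t)) :
    IsCYType (monicQuadratic (RatFunc.X : Qz)⁻¹ (quadraticCoeff s t)) := by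
  have hdeg : (C l * selfDualCubic dz s t).natDegree = 3 := by
    rw [natDegree_C_mul hl]; exact natDegree_cubic _ _ _
  have hdegP := natDegree_monicQuadratic (RatFunc.X : Qz)⁻¹ (quadraticCoeff s t)
  obtain ⟨r, A₀, A₁, A₂, hA₀, hA₁, hA₂, h₀, h₁, h₂⟩ := exists_powerSeries_of_mum hl hL.mum
  refine ⟨monicQuadratic_isIrreducible dz_inv_X rfl hl hL.irreducible, ?_, ?_, ?_, ?_, ?_⟩
  · refine ⟨(RatFunc.X : Qz)⁻¹, inv_ne_zero RatFunc.X_ne_zero, monicQuadratic_selfDual _ _ _ ?_⟩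
    rw [dz_inv_X]; ring
  · obtain ⟨B, hB0, hB⟩ := exists_ofPowerSeries_quadraticCoeff hA₁ hA₂ h₁ h₂
    obtain ⟨hreg, hind⟩ := indicial_monicQuadratic hB0 hB
    exact ⟨hreg, 0, by rw [hind, hdegP]; simp⟩
  · obtain ⟨y, hy0, hyN, hy⟩ := hL.nIntegralSolution
    obtain ⟨b, n, u, hb, hu, rfl⟩ := exists_eq_C_mul_X_pow_mul_powerSeries hy0
    rw [act_C_mul_selfDualCubic, smul_eq_zero_iff_right hl] at hy
    have hCb : ι (PowerSeries.C b) ≠ 0 := by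
      rw [HahnSeries.ofPowerSeries_C]; exact HahnSeries.C_ne_zero hb
    have hDb : ∀ x, derLaurent (ι (PowerSeries.C b) * x) = ι (PowerSeries.C b) * derLaurent x := by
      intro x
      rw [derLaurent_mul, derLaurent_ofPowerSeries, PowerSeries.derivative_C, map_zero, mul_zero,
        add_zero]
    rw [map_mul, ← coe_derLaurent] at hy
    simp only [hDb, Algebra.smul_def] at hy
    obtain ⟨w, k, hw1, hwN, -, -, -, hw⟩ := exists_sqrt_solution hA₀ hA₁ hA₂ h₀ h₁ h₂ hβ0 hβ
      (n := n) hu (by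
        apply mul_left_cancel₀ hCb
        linear_combination hy)
    refine ⟨w, by rintro rfl; simp at hw1, hwN ?_, ?_⟩
    · rw [← mul_assoc] at hyN
      exact hyN.of_C_mul_X_pow_mul hb hu
    · rw [act_monicQuadratic, ← coe_derLaurent, Algebra.smul_def, Algebra.smul_def]
      linear_combination hw
  · intro _
    obtain ⟨f, q, hf, hq, hqN⟩ := hL.specialCoordinate (by rw [hdeg]; norm_num)
    obtain ⟨g, hg, hgf⟩ := exists_flag_monicQuadratic hA₀ hA₁ hA₂ h₀ h₁ h₂ hβ0 hβ hl hf
    exact ⟨g, q, hg, ⟨hq.1, hq.2.1, by rw [hgf]; exact hq.2.2⟩, hqN⟩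
  · obtain ⟨f, hf, hS⟩ := hL.nIntegralStructure
    obtain ⟨g, hg, hgf⟩ := exists_flag_monicQuadratic hA₀ hA₁ hA₂ h₀ h₁ h₂ hβ0 hβ hl hf
    refine ⟨g, hg, fun k hk1 hk2 => ?_⟩
    rw [hdegP] at hk2
    obtain rfl : k = 1 := by omega
    rw [hgf]
    exact hS 1 le_rfl (by rw [hdeg]; norm_num)

end LocalAnalysis

end CYOp

end

theorem mainTheorem12 (L : Polynomial CYOp.Qz) (hL : CYOp.IsCYType L) (hdeg : L.natDegree = 3) :
    ∃ (g : CYOp.Qalg) (P Q : Polynomial CYOp.Qz), g ≠ 0 ∧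
      CYOp.IsCYType P ∧ P.natDegree = 2 ∧ CYOp.IsSymPower 2 P Q ∧
      CYOp.tensorFun (L.map (algebraMap CYOp.Qz CYOp.Qalg)) g =
        Q.map (algebraMap CYOp.Qz CYOp.Qalg) := by
  obtain ⟨l, s, t, β, hl, hβ0, hβ, rfl⟩ := CYOp.exists_eq_selfDualCubic L hdeg hL.selfDual
  obtain ⟨g, hg0, hg⟩ := CYOp.exists_twist hβ0 hβ
  exact ⟨g, CYOp.monicQuadratic (RatFunc.X : CYOp.Qz)⁻¹ (CYOp.quadraticCoeff s t), _, hg0,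
    CYOp.isCYType_monicQuadratic hl hβ0 hβ hL, CYOp.natDegree_monicQuadratic _ _,
    CYOp.isSymPower_two_symSquare l _ _ hl rfl,
    CYOp.tensorFun_selfDualCubic CYOp.dz_inv_X rfl hg0 hg⟩
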